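/- Let $A$ be one of the following real $3\times 3$ matrices: 1. $\mathrm{diag}(\lambda_1,\lambda_2,1)$ with $\lambda_1,\lambda_2\in\mathbb R\setminus\{1\}$, $\lambda_1\ne\lambda_2$, $\lambda_2\neq 0$; 2. $\mathrm{diag}(1,1,\lambda)$ with $\lambda\in\mathbb R\setminus\{0,1\}$; 3. $\mathrm{diag}(\lambda,1,1)$ with $\lambda\in\mathbb R\setminus\{1\}$; 4. the identity matrix; 5. $\begin{pmatrix}\lambda&0&0\\0&1&1\\0&0&1\end{pmatrix}$ with $\lambda\in\mathbb R\setminus\{1\}$; 6. $\begin{pmatrix}1&1&0\\0&1&0\\0&0&\lambda\end{pmatrix}$ with $\lambda\in\mathbb R\setminus\{0,1\}$; 7. $\begin{pmatrix}1&1&0\\0&1&1\\0&0&1\end{pmatrix}$; 8. $\begin{pmatrix}\cos\varphi&-\sin\varphi&0\\ \sin\varphi&\cos\varphi&0\\0&0&\lambda\end{pmatrix}$ with $\lambda\in\mathbb R\setminus\{0\}$, $\varphi\in(0,\pi)$. Let $G$ be a simply connected (in particular connected) Lie group whose Lie algebra $\mathfrak g$ has a basis $X_1,\dots,X_5$ with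 $[X_1,X_2]=X_3$, $[X_1,X_j]=0$ and $[X_i,X_j]=0$ for $3\le i,j\le 5$, and such that $\mathrm{ad}\,X_2$ maps the span of $X_3,X_4,X_5$ to itself with matrix $A$ (columns are images); these are the groups $G_{5,3,1(\lambda_1,\lambda_2)},\dots,G_{5,3,8(\lambda,\varphi)}$. Identify $\mathfrak g^*$ with $\mathbb R^5$ by the dual basis. A K-orbit is an orbit of the coadjoint representation $\langle K(g)F,U\rangle=\langle F,\mathrm{Ad}(g^{-1})U\rangle$. Let $\mathcal F_G$ be the family of all K-orbits of maximal dimension and $V_G$ their union. Then the orbits in $\mathcal F_G$ are 2-dimensional, $V_G$ is open in $\mathfrak g^*$, and $(V_G,\mathcal F_G)$ is a measurable foliation in the sense of Connes, that is: (a) there is a smooth integrable rank-2 subbundle $P$ of the tangent bundle $TV_G$ whose leaves (the maximal connected immersed submanifolds of $V_G$ with tangent spaces $P_x$) are exactly the K-orbits in $\mathcal F_G$, and $P$ is spanned by a smooth nowhere vanishing tangent 2-vector field, i.e. a smooth nowhere vanishing section of $\Lambda^2P$; (b) the foliation carries a non-zero transverse measure: a $\sigma$-additive map $\Lambda$, not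 identically zero, from the Borel transversals (Borel sets $B\subseteq V_G$ meeting each leaf in a countable set) to $[0,+\infty]$ such that $\Lambda(B_1)=\Lambda(B_2)$ whenever there is a Borel bijection $\psi:B_1\to B_2$ with $\psi(x)$ on the leaf of $x$ for all $x\in B_1$, and $\Lambda(K)<+\infty$ for every compact subset $K$ of a smooth transversal submanifold of $V_G$. -/

import Mathlib

open scoped Manifold ContDiff

/-! ### The Lie algebras -/

/-- The eight families of real `3 × 3` matrices that occur as `ad X₂` restricted to the derived
ideal `ℝX₃ ⊕ ℝX₄ ⊕ ℝX₅`. -/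
inductive IsMD5Matrix : Matrix (Fin 3) (Fin 3) ℝ → Prop
  | g1 (a b : ℝ) (ha : a ≠ 1) (hb : b ≠ 1) (hab : a ≠ b) (hb0 : b ≠ 0) :
      IsMD5Matrix !![a, 0, 0; 0, b, 0; 0, 0, 1]
  | g2 (a : ℝ) (ha0 : a ≠ 0) (ha : a ≠ 1) : IsMD5Matrix !![1, 0, 0; 0, 1, 0; 0, 0, a]
  | g3 (a : ℝ) (ha : a ≠ 1) : IsMD5Matrix !![a, 0, 0; 0, 1, 0; 0, 0, 1]
  | g4 : IsMD5Matrix !![1, 0, 0; 0, 1, 0; 0, 0, 1]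
  | g5 (a : ℝ) (ha : a ≠ 1) : IsMD5Matrix !![a, 0, 0; 0, 1, 1; 0, 0, 1]
  | g6 (a : ℝ) (ha0 : a ≠ 0) (ha : a ≠ 1) : IsMD5Matrix !![1, 1, 0; 0, 1, 0; 0, 0, a]
  | g7 : IsMD5Matrix !![1, 1, 0; 0, 1, 1; 0, 0, 1]
  | g8 (a φ : ℝ) (ha0 : a ≠ 0) (hφ0 : 0 < φ) (hφ : φ < Real.pi) :
      IsMD5Matrix
        !![Real.cos φ, -Real.sin φ, 0; Real.sin φ, Real.cos φ, 0; 0, 0, a]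

/-- A Lie group modelled on `ℝ⁵` is a manifold with this model. -/
abbrev Model5 : Type := EuclideanSpace ℝ (Fin 5)

section Group

variable {G : Type*} [TopologicalSpace G] [ChartedSpace Model5 G] [Group G]

/-- The basis `X 0, …, X 4` (that is, `X₁, …, X₅`) of the Lie algebra of `G` satisfies
`[X₁, X₂] = X₃`, `[X₁, X₃] = [X₁, X₄] = [X₁, X₅] = 0`, the span of `X₃, X₄, X₅` is commutative,
and `ad X₂` acts on it by the matrix `A` (the columns of `A` are the images of the basis vectors).
The index of `X₃, X₄, X₅` is `Fin.natAdd 2 j` for `j : Fin 3`. -/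
structure IsMD5Basis (A : Matrix (Fin 3) (Fin 3) ℝ)
    (X : Module.Basis (Fin 5) ℝ (GroupLieAlgebra (𝓡 5) G)) : Prop where
  bracket_zero_one : ⁅X 0, X 1⁆ = X 2
  bracket_zero : ∀ j : Fin 3, ⁅X 0, X (Fin.natAdd 2 j)⁆ = 0
  bracket_one : ∀ j : Fin 3,
    ⁅X 1, X (Fin.natAdd 2 j)⁆ = ∑ i : Fin 3, A i j • X (Fin.natAdd 2 i)
  bracket_derived : ∀ i j : Fin 3, ⁅X (Fin.natAdd 2 i), X (Fin.natAdd 2 j)⁆ = 0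

/-! ### The coadjoint representation -/

/-- The adjoint representation: `Ad g` is the differential at `1` of `x ↦ g x g⁻¹`. (It takes
values in the tangent space at `g 1 g⁻¹ = 1`.) -/
noncomputable def adjointMap (g : G) : GroupLieAlgebra (𝓡 5) G →ₗ[ℝ] GroupLieAlgebra (𝓡 5) G :=
  (show GroupLieAlgebra (𝓡 5) G →L[ℝ] GroupLieAlgebra (𝓡 5) G from
    mfderiv (𝓡 5) (𝓡 5) (fun x : G => g * x * g⁻¹) (1 : G)).toLinearMap

/-- The coadjoint representation: `⟨K g F, U⟩ = ⟨F, Ad g⁻¹ U⟩`. -/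
noncomputable def coadjointMap (g : G) (F : Module.Dual ℝ (GroupLieAlgebra (𝓡 5) G)) :
    Module.Dual ℝ (GroupLieAlgebra (𝓡 5) G) :=
  F ∘ₗ adjointMap g⁻¹

/-- The coadjoint representation on `ℝ⁵`, which is identified with the dual of the Lie algebra
by the basis dual to `X`. -/
noncomputable def coadjointCoord (X : Module.Basis (Fin 5) ℝ (GroupLieAlgebra (𝓡 5) G)) (g : G)
    (F : Fin 5 → ℝ) : Fin 5 → ℝ :=
  X.dualBasis.equivFun (coadjointMap g (X.dualBasis.equivFun.symm F))

/-- The K-orbit of `F`. -/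
def kOrbit (X : Module.Basis (Fin 5) ℝ (GroupLieAlgebra (𝓡 5) G)) (F : Fin 5 → ℝ) :
    Set (Fin 5 → ℝ) :=
  Set.range fun g : G => coadjointCoord X g F

/-- The dimension of the K-orbit of `F`: the rank of the orbit map `g ↦ K g F` (at `1`; by
equivariance this rank is the same at every point). -/
noncomputable def kOrbitDim (X : Module.Basis (Fin 5) ℝ (GroupLieAlgebra (𝓡 5) G))
    (F : Fin 5 → ℝ) : ℕ :=
  Module.finrank ℝ (LinearMap.range
    (mfderiv (𝓡 5) 𝓘(ℝ, Fin 5 → ℝ) (fun g : G => coadjointCoord X g F) (1 : G) :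
      Model5 →L[ℝ] (Fin 5 → ℝ)).toLinearMap)

/-- The family of all K-orbits of maximal dimension. -/
def maximalKOrbits (X : Module.Basis (Fin 5) ℝ (GroupLieAlgebra (𝓡 5) G)) :
    Set (Set (Fin 5 → ℝ)) :=
  {Ω | ∃ F : Fin 5 → ℝ, (∀ F' : Fin 5 → ℝ, kOrbitDim X F' ≤ kOrbitDim X F) ∧ Ω = kOrbit X F}

end Group

/-! ### Foliations of an open subset `V` of a finite-dimensional real vector space `W`

The tangent bundle of `V` is `V × W`, so that a subbundle is a family of subspaces of `W`. -/

section Foliation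

variable {W : Type*} [NormedAddCommGroup W] [NormedSpace ℝ W]

/-- `P` is a smooth subbundle of rank `k` of the tangent bundle of `V`. -/
def IsSmoothSubbundle (k : ℕ) (V : Set W) (P : W → Submodule ℝ W) : Prop :=
  ∀ x ∈ V, ∃ U : Set W, IsOpen U ∧ x ∈ U ∧ U ⊆ V ∧ ∃ Y : Fin k → W → W,
    (∀ i, ContDiffOn ℝ ∞ (Y i) U) ∧
    ∀ y ∈ U, LinearIndependent ℝ (fun i => Y i y) ∧
      P y = Submodule.span ℝ (Set.range fun i => Y i y)

/-- `ι : M → W` is an injective smooth immersion of a smooth `d`-dimensional manifold; `M` and `ι`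
present the (immersed) submanifold `range ι` of `W`. -/
structure PresentsSubmanifold (d : ℕ) (M : Type) [TopologicalSpace M]
    [ChartedSpace (EuclideanSpace ℝ (Fin d)) M] (ι : M → W) : Prop where
  isManifold : IsManifold (𝓡 d) ∞ M
  t2 : T2Space M
  secondCountable : SecondCountableTopology M
  smooth : ContMDiff (𝓡 d) 𝓘(ℝ, W) ∞ ι
  injective : Function.Injective ι
  immersion : ∀ m, Function.Injective (mfderiv (𝓡 d) 𝓘(ℝ, W) ι m)

/-- The tangent space of the submanifold `range ι` at `ι m`. -/
noncomputable def submanifoldTangent (d : ℕ) {M : Type} [TopologicalSpace M]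
    [ChartedSpace (EuclideanSpace ℝ (Fin d)) M] (ι : M → W) (m : M) : Submodule ℝ W :=
  LinearMap.range
    (mfderiv (𝓡 d) 𝓘(ℝ, W) ι m : EuclideanSpace ℝ (Fin d) →L[ℝ] W).toLinearMap

/-- `L` is a `k`-dimensional submanifold of `V` whose tangent spaces are given by `P`. -/
def IsIntegralManifold (k : ℕ) (V : Set W) (P : W → Submodule ℝ W) (L : Set W) : Prop :=
  ∃ (M : Type) (_ : TopologicalSpace M) (_ : ChartedSpace (EuclideanSpace ℝ (Fin k)) M)
    (ι : M → W), PresentsSubmanifold k M ι ∧ Set.range ι = L ∧ L ⊆ V ∧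
      ∀ m, submanifoldTangent k ι m = P (ι m)

/-- `L` is a connected `k`-dimensional submanifold of `V` whose tangent spaces are given by `P`
(connected in its manifold topology). -/
def IsConnectedIntegralManifold (k : ℕ) (V : Set W) (P : W → Submodule ℝ W) (L : Set W) : Prop :=
  ∃ (M : Type) (_ : TopologicalSpace M) (_ : ChartedSpace (EuclideanSpace ℝ (Fin k)) M)
    (ι : M → W), ConnectedSpace M ∧ PresentsSubmanifold k M ι ∧ Set.range ι = L ∧ L ⊆ V ∧
      ∀ m, submanifoldTangent k ι m = P (ι m)

/-- `L` is a leaf: a maximal connected integral manifold. -/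
def IsLeaf (k : ℕ) (V : Set W) (P : W → Submodule ℝ W) (L : Set W) : Prop :=
  IsConnectedIntegralManifold k V P L ∧
    ∀ L', IsConnectedIntegralManifold k V P L' → L ⊆ L' → L' = L

/-- `(V, P)` is a foliation of dimension `k`, and `C` is the family of its leaves: `P` is a smooth
integrable subbundle of the tangent bundle of the open set `V`, and `C` consists of the maximal
connected integral manifolds of `P`. -/
structure IsFoliation (k : ℕ) (V : Set W) (P : W → Submodule ℝ W) (C : Set (Set W)) : Prop where
  isOpen : IsOpen V
  smooth : IsSmoothSubbundle k V P
  integrable : ∀ x ∈ V, ∃ L, IsIntegralManifold k V P L ∧ x ∈ L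
  leaves : C = {L | IsLeaf k V P L}

/-- `X` is a smooth nowhere vanishing section over `V` of the `k`-th exterior power of `P`.
Smoothness is smoothness of the coordinates in the finite-dimensional space `⋀ᵏ W`. -/
structure IsTangentMultivectorField (k : ℕ) (V : Set W) (P : W → Submodule ℝ W)
    (X : W → ⋀[ℝ]^k W) : Prop where
  smooth : ∀ l : Module.Dual ℝ (⋀[ℝ]^k W), ContDiffOn ℝ ∞ (fun x => l (X x)) V
  tangent : ∀ x ∈ V, X x ∈ LinearMap.range (exteriorPower.map k (P x).subtype)
  ne_zero : ∀ x ∈ V, X x ≠ 0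

/-! ### Transverse measures -/

variable [MeasurableSpace W]

/-- `B` is a Borel subset of `V` that meets every leaf in a countable set. -/
def IsBorelTransversal (V : Set W) (C : Set (Set W)) (B : Set W) : Prop :=
  MeasurableSet B ∧ B ⊆ V ∧ ∀ L ∈ C, (B ∩ L).Countable

/-- `Λ` is a transverse measure for the foliation `(V, P)` with family of leaves `C`. Only the
values of `Λ` on Borel transversals matter. -/
structure IsTransverseMeasure (V : Set W) (P : W → Submodule ℝ W) (C : Set (Set W))
    (Λ : Set W → ENNReal) : Prop where
  empty : Λ ∅ = 0
  iUnion : ∀ B : ℕ → Set W, (∀ n, IsBorelTransversal V C (B n)) →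
    Pairwise (fun m n => Disjoint (B m) (B n)) → Λ (⋃ n, B n) = ∑' n, Λ (B n)
  invariant : ∀ (B₁ B₂ : Set W) (ψ : W → W), IsBorelTransversal V C B₁ →
    IsBorelTransversal V C B₂ → Set.BijOn ψ B₁ B₂ → Measurable (fun x : B₁ => ψ x) →
    (∀ x ∈ B₁, ∃ L ∈ C, x ∈ L ∧ ψ x ∈ L) → Λ B₁ = Λ B₂
  finite : ∀ (d : ℕ) (M : Type) [TopologicalSpace M]
    [ChartedSpace (EuclideanSpace ℝ (Fin d)) M] (ι : M → W),
    PresentsSubmanifold d M ι → (∀ m, ι m ∈ V) →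
    (∀ m, IsCompl (submanifoldTangent d ι m) (P (ι m))) →
    ∀ K : Set M, IsCompact K → Λ (ι '' K) < ⊤

/-- The foliation `(V, P)` with family of leaves `C` is measurable: it carries a transverse
measure, and not only the zero one. -/
def IsMeasurableFoliation (V : Set W) (P : W → Submodule ℝ W) (C : Set (Set W)) : Prop :=
  ∃ Λ : Set W → ENNReal, IsTransverseMeasure V P C Λ ∧
    ∃ B, IsBorelTransversal V C B ∧ Λ B ≠ 0

end Foliation

/-! Let N be the infinitesimal action F ↦ F ∘ ad X₂ on the dual space (`adDual X (X 1)`), and e the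
dual basis vector of X₂. The vectors X₁, X₃, X₄, X₅ commute with one another, so antisymmetry of the
bracket forces F ∘ ad X_l = -(N F)_l e for each of them (`adDual_basis_of_ne`). Hence the tangent
space of the orbit of F is 0 if N F = 0, and is spanned by e and N F otherwise. These two vectors
are then independent, because the X₂-coordinate ε kills the image of N while ε e = 1. The last row
of A makes N nonzero at the dual vector of X₅, so the maximal dimension is 2 and V_G = {N F ≠ 0}.

Since N e = 0, the flow of N commutes with translation along e, and the K-orbits in V_G are the sets
{exp(tN) F + b e} (`kOrbit_eq_splitOrbit`). One inclusion says that a map from a connected manifold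
tangent to span(e, N) stays in one such set. The other realizes both flows by group elements. This
rests on the fact that the differential of Ad is the Lie bracket (`mfderiv_lieAd_apply`), proved by
differentiating the group law twice in a chart.

Each such set is an injectively immersed plane or cylinder, according to whether the stabilizer of F
under the flow of N is trivial or infinite cyclic. It contains every connected integral manifold
that meets it, so these sets are the leaves (`isLeaf_iff`). The 2-vector field is e ∧ N F.

For the transverse measure a single closed union of leaves suffices. The subspace where the
coordinates at X₁, X₃, X₄ vanish is invariant and meets V_G in two half-planes that are leaves.
Counting the points of a transversal on them is invariant under leafwise bijections, is finite on
compact pieces of smooth transversals because transversality isolates the intersection points, and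
is nonzero on a singleton (`isMeasurableFoliation_of_comp_eq`). -/

open Topology Filter

/-! ### The adjoint representation and the Lie bracket -/

section LocalGroupLaw

variable {E : Type*} [NormedAddCommGroup E] [NormedSpace ℝ E]

/-- For a local group law `m` with unit `e`, let `a x` be the vector which right translation by `x`
sends to the left translate by `x` of `w`. The derivative of `a` at the unit is the Lie bracket of
left invariant vector fields. -/
theorem localGroupLaw_fderiv_eq_lieBracket {m : E × E → E} {e : E} {a : E → E} {a' : E →L[ℝ] E}
    (hm : ContDiffAt ℝ 2 m (e, e)) (hl : ∀ᶠ y in 𝓝 e, m (e, y) = y)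
    (hr : ∀ᶠ x in 𝓝 e, m (x, e) = x) (ha : HasFDerivAt a a' e) {w : E}
    (h : ∀ᶠ x in 𝓝 e, fderiv ℝ m (x, e) (0, w) = fderiv ℝ m (e, x) (a x, 0)) (u : E) :
    a' u = VectorField.lieBracket ℝ (fun x => fderiv ℝ m (x, e) (0, u))
      (fun x => fderiv ℝ m (x, e) (0, w)) e := by
  have hsymm : IsSymmSndFDerivAt ℝ m (e, e) :=
    hm.isSymmSndFDerivAt (by simp [minSmoothness_of_isRCLikeNormedField])
  have hm1 : HasFDerivAt (fderiv ℝ m) (fderiv ℝ (fderiv ℝ m) (e, e)) (e, e) :=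
    ((hm.fderiv_right (m := 1) (by norm_num)).differentiableAt (by simp)).hasFDerivAt
  have hm0 : HasFDerivAt m (fderiv ℝ m (e, e)) (e, e) :=
    (hm.differentiableAt (by simp)).hasFDerivAt
  have i1 : HasFDerivAt (fun x : E => (x, e)) (ContinuousLinearMap.inl ℝ E E) e :=
    hasFDerivAt_prodMk_left e e
  have i2 : HasFDerivAt (fun x : E => (e, x)) (ContinuousLinearMap.inr ℝ E E) e :=
    hasFDerivAt_prodMk_right e e
  have d1 : ∀ v, fderiv ℝ m (e, e) (v, 0) = v := fun v => by
    have h1 : HasFDerivAt (fun x => m (x, e)) _ e := hm0.comp (f := fun x : E => (x, e)) e i1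
    have h2 : HasFDerivAt (fun x => m (x, e)) (ContinuousLinearMap.id ℝ E) e :=
      (hasFDerivAt_id e).congr_of_eventuallyEq hr
    simpa using DFunLike.congr_fun (h1.unique h2) v
  have d2 : ∀ v, fderiv ℝ m (e, e) (0, v) = v := fun v => by
    have h1 : HasFDerivAt (fun x => m (e, x)) _ e := hm0.comp (f := fun x : E => (e, x)) e i2
    have h2 : HasFDerivAt (fun x => m (e, x)) (ContinuousLinearMap.id ℝ E) e :=
      (hasFDerivAt_id e).congr_of_eventuallyEq hl
    simpa using DFunLike.congr_fun (h1.unique h2) v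
  have j1 : HasFDerivAt (fun x => fderiv ℝ m (x, e)) _ e := hm1.comp (f := fun x : E => (x, e)) e i1
  have j2 : HasFDerivAt (fun x => fderiv ℝ m (e, x)) _ e := hm1.comp (f := fun x : E => (e, x)) e i2
  have hV : ∀ v, HasFDerivAt (fun x => fderiv ℝ m (x, e) (0, v)) _ e := fun v =>
    j1.clm_apply (hasFDerivAt_const (0, v) e)
  have hR : HasFDerivAt (fun x => fderiv ℝ m (e, x) (a x, 0)) _ e :=
    j2.clm_apply (ha.prodMk (hasFDerivAt_const (0 : E) e))
  -- Differentiating `h` at `e` along `u` gives D²m((u,0),(0,w)) = D²m((0,u),(w,0)) + a' u. Symmetry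
  -- of D²m turns this into the formula for the bracket.
  have hR' := (hR.congr_of_eventuallyEq h).unique (hV w)
  have hae : a e = w := by
    have := h.self_of_nhds
    rwa [d1, d2, eq_comm] at this
  have key := DFunLike.congr_fun hR' u
  simp only [hae, add_apply, ContinuousLinearMap.comp_apply,
    ContinuousLinearMap.flip_apply, ContinuousLinearMap.prod_apply,
    zero_apply, d1, ContinuousLinearMap.inl_apply,
    ContinuousLinearMap.inr_apply, map_zero] at key
  simp only [VectorField.lieBracket, (hV _).fderiv, d2, add_apply,
    ContinuousLinearMap.comp_apply, ContinuousLinearMap.flip_apply,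
    zero_apply, ContinuousLinearMap.inl_apply, map_zero]
  have s := hsymm.eq (w, 0) (0, u)
  rw [s]
  simp only [zero_add] at key ⊢
  rw [← key]
  abel

end LocalGroupLaw

/-! ### The adjoint representation as a smooth homomorphism -/

section LieGroup

variable {E : Type*} [NormedAddCommGroup E] [NormedSpace ℝ E]
  {G : Type*} [TopologicalSpace G] [ChartedSpace E G] [Group G]

/-- The differential at `1` of conjugation by `g`. -/
noncomputable def lieAd (g : G) : E →L[ℝ] E := 
   (mfderiv 𝓘(ℝ, E) 𝓘(ℝ, E) (fun x : G => g * x * g⁻¹) (1 : G))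

theorem lieAd_one : lieAd (E := E) (1 : G) = ContinuousLinearMap.id ℝ E := by
  have h : (fun x : G => (1 : G) * x * 1⁻¹) = id := by ext; simp
  rw [lieAd, h]
  exact mfderiv_id

variable [LieGroup 𝓘(ℝ, E) ∞ G]

/-- A differential depends smoothly on parameters when read in tangent bundle coordinates. Here
those coordinate changes are trivial, because every conjugation fixes `1`. -/
theorem contMDiff_lieAd : ContMDiff 𝓘(ℝ, E) 𝓘(ℝ, E →L[ℝ] E) ∞ (lieAd (E := E) (G := G)) := by
  intro g₀
  have hc : ContMDiffAt (𝓘(ℝ, E).prod 𝓘(ℝ, E)) 𝓘(ℝ, E) ∞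
      (Function.uncurry fun (g x : G) => g * x * g⁻¹) (g₀, 1) := by
    have h : ContMDiff (𝓘(ℝ, E).prod 𝓘(ℝ, E)) 𝓘(ℝ, E) ∞ (fun p : G × G => p.1 * p.2 * p.1⁻¹) :=
      (contMDiff_fst.mul contMDiff_snd).mul contMDiff_fst.inv
    exact h.contMDiffAt
  have h : ContMDiffAt 𝓘(ℝ, E) 𝓘(ℝ, E →L[ℝ] E) ∞ (inTangentCoordinates 𝓘(ℝ, E) 𝓘(ℝ, E)
      (fun _ : G => (1 : G)) (fun g : G => g * 1 * g⁻¹) (lieAd (E := E) (G := G)) g₀) g₀ :=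
    ContMDiffAt.mfderiv (I := 𝓘(ℝ, E)) (I' := 𝓘(ℝ, E)) (m := ∞)
      (fun (g x : G) => g * x * g⁻¹) (fun _ => 1) hc contMDiffAt_const (by simp)
  have h1 : (fun g : G => g * 1 * g⁻¹) = fun _ => 1 := by ext; simp
  rw [h1] at h
  have h2 : (inTangentCoordinates 𝓘(ℝ, E) 𝓘(ℝ, E) (fun _ : G => (1 : G)) (fun _ : G => (1 : G))
      (lieAd (E := E) (G := G)) g₀) = lieAd (E := E) (G := G) := by
    ext g v
    rw [inTangentCoordinates_eq (fun _ : G => (1 : G)) (fun _ : G => (1 : G)) _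
      (mem_chart_source E (1 : G)) (mem_chart_source E (1 : G))]
    have hs : (1 : G) ∈ (tangentBundleCore 𝓘(ℝ, E) G).baseSet (achart E (1 : G)) :=
      mem_chart_source E (1 : G)
    simp only [ContinuousLinearMap.comp_apply]
    erw [(tangentBundleCore 𝓘(ℝ, E) G).coordChange_self _ _ hs,
      (tangentBundleCore 𝓘(ℝ, E) G).coordChange_self _ _ hs]
  rwa [h2] at h

theorem lieAd_mul (g h : G) : lieAd (E := E) (g * h) = (lieAd g).comp (lieAd h) := by
  have hd : ∀ g x : G, MDifferentiableAt 𝓘(ℝ, E) 𝓘(ℝ, E) (fun x : G => g * x * g⁻¹) x :=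
    fun g x => ((contMDiff_mul_left (a := g)).mul contMDiff_const).mdifferentiableAt
      (n := ∞) (by simp)
  have hc : (fun x : G => g * h * x * (g * h)⁻¹) =
      (fun x : G => g * x * g⁻¹) ∘ (fun x : G => h * x * h⁻¹) := by
    ext x; simp [mul_assoc]
  have h1 : h * 1 * h⁻¹ = 1 := by simp
  have key := mfderiv_comp (1 : G) (hd g (h * 1 * h⁻¹)) (hd h 1)
  rw [← hc] at key
  unfold lieAd
  refine key.trans ?_
  rw [h1]
  rfl

/-- Left translates of tangent vectors at `1` are right translates by way of the adjoint
representation. -/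
theorem mfderiv_mul_left_eq_mfderiv_mul_right_lieAd (g : G) (w : E) :
    (mfderiv 𝓘(ℝ, E) 𝓘(ℝ, E) (fun x : G => g * x) (1 : G) w : E) =
      (mfderiv 𝓘(ℝ, E) 𝓘(ℝ, E) (fun x : G => x * g) (1 : G)
        (lieAd (E := E) g w) : E) := by
  have hd : MDifferentiableAt 𝓘(ℝ, E) 𝓘(ℝ, E) (fun x : G => g * x * g⁻¹) 1 :=
    ((contMDiff_mul_left (a := g)).mul contMDiff_const).mdifferentiableAt (n := ∞) (by simp)
  have hr : MDifferentiableAt 𝓘(ℝ, E) 𝓘(ℝ, E) (fun x : G => x * g) (g * 1 * g⁻¹) :=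
    contMDiff_mul_right.mdifferentiableAt (n := ∞) (by simp)
  have hc : (fun x : G => g * x) = (fun x : G => x * g) ∘ (fun x : G => g * x * g⁻¹) := by
    ext x; simp
  have h1 : g * 1 * g⁻¹ = 1 := by simp
  have key := mfderiv_comp (1 : G) hr hd
  rw [← hc] at key
  refine (DFunLike.congr_fun key w).trans ?_
  rw [h1]
  rfl

end LieGroup

/-! ### The group law and the Lie bracket in a chart at the unit -/

section LieGroupChart

variable {E : Type*} [NormedAddCommGroup E] [NormedSpace ℝ E]
  {G : Type*} [TopologicalSpace G] [ChartedSpace E G]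

theorem contMDiffAt_extChartAt_symm_of_mem [IsManifold 𝓘(ℝ, E) ∞ G] {g : G} {x : E}
    (hx : x ∈ (extChartAt 𝓘(ℝ, E) g).target) :
    ContMDiffAt 𝓘(ℝ, E) 𝓘(ℝ, E) ∞ (extChartAt 𝓘(ℝ, E) g).symm x :=
  (contMDiffOn_extChartAt_symm g).contMDiffAt ((isOpen_extChartAt_target g).mem_nhds hx)

theorem mfderiv_extChartAt_symm_self [IsManifold 𝓘(ℝ, E) ∞ G] (g : G) (v : E) :
    (mfderiv 𝓘(ℝ, E) 𝓘(ℝ, E) (extChartAt 𝓘(ℝ, E) g).symm (extChartAt 𝓘(ℝ, E) g g) v : E) = v := by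
  have : IsManifold 𝓘(ℝ, E) 1 G := .of_le (n := ∞) (by simp)
  have h := mfderivWithin_range_extChartAt_symm (I := 𝓘(ℝ, E)) (x := g)
  rw [modelWithCornersSelf_coe, Set.range_id, mfderivWithin_univ] at h
  exact DFunLike.congr_fun h v

variable [Group G]

variable (G) in
/-- The multiplication of a Lie group in the preferred chart at `1`. -/
noncomputable def lieChartMul (p : E × E) : E :=
  extChartAt 𝓘(ℝ, E) (1 : G)
    ((extChartAt 𝓘(ℝ, E) (1 : G)).symm p.1 * (extChartAt 𝓘(ℝ, E) (1 : G)).symm p.2)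

variable [LieGroup 𝓘(ℝ, E) ∞ G]

theorem contDiffAt_lieChartMul {x y : E} (hx : x ∈ (extChartAt 𝓘(ℝ, E) (1 : G)).target)
    (hy : y ∈ (extChartAt 𝓘(ℝ, E) (1 : G)).target)
    (hxy : (extChartAt 𝓘(ℝ, E) (1 : G)).symm x * (extChartAt 𝓘(ℝ, E) (1 : G)).symm y ∈
      (chartAt E (1 : G)).source) :
    ContDiffAt ℝ ∞ (lieChartMul (E := E) G) (x, y) := by
  rw [← contMDiffAt_iff_contDiffAt]
  have h1 : ContMDiffAt 𝓘(ℝ, E × E) 𝓘(ℝ, E) ∞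
      (fun p : E × E => (extChartAt 𝓘(ℝ, E) (1 : G)).symm p.1) (x, y) :=
    (contMDiffAt_extChartAt_symm_of_mem hx).comp (x, y)
      (contDiff_fst.contMDiff.contMDiffAt)
  have h2 : ContMDiffAt 𝓘(ℝ, E × E) 𝓘(ℝ, E) ∞
      (fun p : E × E => (extChartAt 𝓘(ℝ, E) (1 : G)).symm p.2) (x, y) :=
    (contMDiffAt_extChartAt_symm_of_mem hy).comp (x, y)
      (contDiff_snd.contMDiff.contMDiffAt)
  exact (contMDiffAt_extChartAt' hxy).comp (x, y) (h1.mul h2)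

/-- Chain rule for φ ∘ L_g ∘ φ⁻¹, where φ⁻¹ has identity differential at φ(1). With its companion
for right translations, this puts the Lie group into the setting of
`localGroupLaw_fderiv_eq_lieBracket`. -/
theorem fderiv_lieChartMul_right {x : E} (hx : x ∈ (extChartAt 𝓘(ℝ, E) (1 : G)).target) (w : E) :
    fderiv ℝ (lieChartMul (E := E) G) (x, extChartAt 𝓘(ℝ, E) (1 : G) 1) (0, w) =
      mfderiv 𝓘(ℝ, E) 𝓘(ℝ, E) (extChartAt 𝓘(ℝ, E) (1 : G)) ((extChartAt 𝓘(ℝ, E) (1 : G)).symm x)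
        (mfderiv 𝓘(ℝ, E) 𝓘(ℝ, E)
          (fun y : G => (extChartAt 𝓘(ℝ, E) (1 : G)).symm x * y) (1 : G) w : E) := by
  set φ := extChartAt 𝓘(ℝ, E) (1 : G) with hφ
  set g := φ.symm x with hg
  have hφ1 : φ.symm (φ 1) = 1 := extChartAt_to_inv (1 : G)
  have hgs : g ∈ (chartAt E (1 : G)).source := by
    rw [← extChartAt_source 𝓘(ℝ, E)]; exact φ.map_target hx
  have hm : DifferentiableAt ℝ (lieChartMul (E := E) G) (x, φ 1) :=
    (contDiffAt_lieChartMul hx (mem_extChartAt_target (1 : G))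
      (by rw [← hφ, hφ1, mul_one]; exact hgs)).differentiableAt (by simp)
  have e1 : fderiv ℝ (lieChartMul (E := E) G) (x, φ 1) (0, w) =
      fderiv ℝ (fun y => lieChartMul (E := E) G (x, y)) (φ 1) w := by
    have := (hm.hasFDerivAt.comp (f := fun y : E => (x, y)) (φ 1) (hasFDerivAt_prodMk_right x _))
    rw [show (fun y => lieChartMul (E := E) G (x, y)) =
      lieChartMul (E := E) G ∘ (fun y : E => (x, y)) from rfl,
      this.fderiv]
    simp
  rw [e1, ← mfderiv_eq_fderiv]
  have hs : MDifferentiableAt 𝓘(ℝ, E) 𝓘(ℝ, E) φ.symm (φ 1) :=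
    (contMDiffAt_extChartAt_symm_of_mem (mem_extChartAt_target (1 : G))).mdifferentiableAt
      (by simp)
  have hL : MDifferentiableAt 𝓘(ℝ, E) 𝓘(ℝ, E) (fun y : G => g * y) (φ.symm (φ 1)) :=
    (contMDiff_mul_left (a := g)).mdifferentiableAt (n := ∞) (by simp)
  have hc : MDifferentiableAt 𝓘(ℝ, E) 𝓘(ℝ, E) φ (g * φ.symm (φ 1)) :=
    (contMDiffAt_extChartAt' (n := ∞) (by rw [hφ1, mul_one]; exact hgs)).mdifferentiableAt
      (by simp)
  have key : mfderiv 𝓘(ℝ, E) 𝓘(ℝ, E) (fun y => lieChartMul (E := E) G (x, y)) (φ 1) = _ :=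
    (mfderiv_comp (φ 1) hc (hL.comp (φ 1) hs))
  have key2 := mfderiv_comp (φ 1) hL hs
  refine (DFunLike.congr_fun key w).trans ?_
  refine (congrArg (mfderiv 𝓘(ℝ, E) 𝓘(ℝ, E) φ (g * φ.symm (φ 1)))
    (DFunLike.congr_fun key2 w)).trans ?_
  refine (congrArg (fun v : E => (mfderiv 𝓘(ℝ, E) 𝓘(ℝ, E) φ (g * φ.symm (φ 1)))
    (mfderiv 𝓘(ℝ, E) 𝓘(ℝ, E) (fun y : G => g * y) (φ.symm (φ 1)) v : E))
    (mfderiv_extChartAt_symm_self (1 : G) w)).trans ?_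
  rw [hφ1, mul_one]

theorem fderiv_lieChartMul_left {x : E} (hx : x ∈ (extChartAt 𝓘(ℝ, E) (1 : G)).target) (w : E) :
    fderiv ℝ (lieChartMul (E := E) G) (extChartAt 𝓘(ℝ, E) (1 : G) 1, x) (w, 0) =
      mfderiv 𝓘(ℝ, E) 𝓘(ℝ, E) (extChartAt 𝓘(ℝ, E) (1 : G)) ((extChartAt 𝓘(ℝ, E) (1 : G)).symm x)
        (mfderiv 𝓘(ℝ, E) 𝓘(ℝ, E)
          (fun y : G => y * (extChartAt 𝓘(ℝ, E) (1 : G)).symm x) (1 : G) w : E) := by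
  set φ := extChartAt 𝓘(ℝ, E) (1 : G) with hφ
  set g := φ.symm x with hg
  have hφ1 : φ.symm (φ 1) = 1 := extChartAt_to_inv (1 : G)
  have hgs : g ∈ (chartAt E (1 : G)).source := by
    rw [← extChartAt_source 𝓘(ℝ, E)]; exact φ.map_target hx
  have hm : DifferentiableAt ℝ (lieChartMul (E := E) G) (φ 1, x) :=
    (contDiffAt_lieChartMul (mem_extChartAt_target (1 : G)) hx
      (by rw [← hφ, hφ1, one_mul]; exact hgs)).differentiableAt (by simp)
  have e1 : fderiv ℝ (lieChartMul (E := E) G) (φ 1, x) (w, 0) =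
      fderiv ℝ (fun y => lieChartMul (E := E) G (y, x)) (φ 1) w := by
    have := (hm.hasFDerivAt.comp (f := fun y : E => (y, x)) (φ 1) (hasFDerivAt_prodMk_left _ x))
    rw [show (fun y => lieChartMul (E := E) G (y, x)) =
      lieChartMul (E := E) G ∘ (fun y : E => (y, x)) from rfl,
      this.fderiv]
    simp
  rw [e1, ← mfderiv_eq_fderiv]
  have hs : MDifferentiableAt 𝓘(ℝ, E) 𝓘(ℝ, E) φ.symm (φ 1) :=
    (contMDiffAt_extChartAt_symm_of_mem (mem_extChartAt_target (1 : G))).mdifferentiableAt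
      (by simp)
  have hL : MDifferentiableAt 𝓘(ℝ, E) 𝓘(ℝ, E) (fun y : G => y * g) (φ.symm (φ 1)) :=
    (contMDiff_mul_right (a := g)).mdifferentiableAt (n := ∞) (by simp)
  have hc : MDifferentiableAt 𝓘(ℝ, E) 𝓘(ℝ, E) φ (φ.symm (φ 1) * g) :=
    (contMDiffAt_extChartAt' (n := ∞) (by rw [hφ1, one_mul]; exact hgs)).mdifferentiableAt
      (by simp)
  have key : mfderiv 𝓘(ℝ, E) 𝓘(ℝ, E) (fun y => lieChartMul (E := E) G (y, x)) (φ 1) = _ :=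
    (mfderiv_comp (φ 1) hc (hL.comp (φ 1) hs))
  have key2 := mfderiv_comp (φ 1) hL hs
  refine (DFunLike.congr_fun key w).trans ?_
  refine (congrArg (mfderiv 𝓘(ℝ, E) 𝓘(ℝ, E) φ (φ.symm (φ 1) * g))
    (DFunLike.congr_fun key2 w)).trans ?_
  refine (congrArg (fun v : E => (mfderiv 𝓘(ℝ, E) 𝓘(ℝ, E) φ (φ.symm (φ 1) * g))
    (mfderiv 𝓘(ℝ, E) 𝓘(ℝ, E) (fun y : G => y * g) (φ.symm (φ 1)) v : E))
    (mfderiv_extChartAt_symm_self (1 : G) w)).trans ?_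
  rw [hφ1, one_mul]

/-- The Lie bracket of a Lie group in terms of the multiplication in the preferred chart at `1`. -/
theorem groupLieAlgebra_bracket_eq (u w : GroupLieAlgebra 𝓘(ℝ, E) G) :
    (⁅u, w⁆ : GroupLieAlgebra 𝓘(ℝ, E) G) = (VectorField.lieBracket ℝ
      (fun x => fderiv ℝ (lieChartMul (E := E) G) (x, extChartAt 𝓘(ℝ, E) (1 : G) 1) (0, u))
      (fun x => fderiv ℝ (lieChartMul (E := E) G) (x, extChartAt 𝓘(ℝ, E) (1 : G) 1) (0, w))
      (extChartAt 𝓘(ℝ, E) (1 : G) 1) : E) := by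
  have : IsManifold 𝓘(ℝ, E) 1 G := .of_le (n := ∞) (by simp)
  rw [GroupLieAlgebra.bracket_def, ← VectorField.mlieBracketWithin_univ,
    VectorField.mlieBracketWithin_apply, mfderiv_extChartAt_self]
  -- In the chart, the left invariant field generated by `v` is the partial derivative of the
  -- product in its second argument at the unit.
  have hpull : ∀ v : E, ∀ᶠ x in 𝓝 (extChartAt 𝓘(ℝ, E) (1 : G) 1),
      VectorField.mpullbackWithin 𝓘(ℝ, E) 𝓘(ℝ, E) (extChartAt 𝓘(ℝ, E) (1 : G)).symm
        (mulInvariantVectorField (I := 𝓘(ℝ, E)) (G := G) v) (Set.range 𝓘(ℝ, E)) x =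
      fderiv ℝ (lieChartMul (E := E) G) (x, extChartAt 𝓘(ℝ, E) (1 : G) 1) (0, v) := by
    intro v
    filter_upwards [extChartAt_target_mem_nhds (I := 𝓘(ℝ, E)) (1 : G)] with x hx
    rw [fderiv_lieChartMul_right hx, VectorField.mpullbackWithin_apply,
      ContinuousLinearMap.inverse_eq (mfderivWithin_extChartAt_symm_comp_mfderiv_extChartAt hx)
        (mfderiv_extChartAt_comp_mfderivWithin_extChartAt_symm hx)]
    rfl
  have hset : (extChartAt 𝓘(ℝ, E) (1 : G)).symm ⁻¹' Set.univ ∩ Set.range 𝓘(ℝ, E) = Set.univ := by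
    simp
  rw [hset]
  refine (DFunLike.congr_fun (ContinuousLinearMap.inverse_id (R := ℝ) (M := E)) _).trans ?_
  refine (congrFun VectorField.lieBracketWithin_univ _).trans ?_
  exact Filter.EventuallyEq.lieBracket_vectorField_eq (hpull u) (hpull w)

/-- The differential of the adjoint representation at `1` is the Lie bracket. -/
theorem mfderiv_lieAd_apply (u w : GroupLieAlgebra 𝓘(ℝ, E) G) :
    mfderiv 𝓘(ℝ, E) 𝓘(ℝ, E) (fun g : G => lieAd (E := E) g w) (1 : G) u =
      (⁅u, w⁆ : GroupLieAlgebra 𝓘(ℝ, E) G) := by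
  have hs : ContMDiff 𝓘(ℝ, E) 𝓘(ℝ, E) ∞ (fun g : G => lieAd (E := E) g w) :=
    contMDiff_lieAd.clm_apply contMDiff_const
  have hd := (hs.mdifferentiableAt (x := 1) (by simp)).hasMFDerivAt
  have ha : HasFDerivAt (fun x => lieAd (E := E) ((extChartAt 𝓘(ℝ, E) (1 : G)).symm x) w)
      (mfderiv 𝓘(ℝ, E) 𝓘(ℝ, E) (fun g : G => lieAd (E := E) g w) (1 : G) : E →L[ℝ] E)
      (extChartAt 𝓘(ℝ, E) (1 : G) 1) := by
    have h := hd.2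
    rw [modelWithCornersSelf_coe, Set.range_id] at h
    exact hasFDerivWithinAt_univ.1 h
  rw [groupLieAlgebra_bracket_eq]
  have h1 : (extChartAt 𝓘(ℝ, E) (1 : G)).symm (extChartAt 𝓘(ℝ, E) (1 : G) 1) = 1 :=
    extChartAt_to_inv (1 : G)
  have ht := extChartAt_target_mem_nhds (I := 𝓘(ℝ, E)) (1 : G)
  refine localGroupLaw_fderiv_eq_lieBracket ?_ ?_ ?_ ha ?_ u
  · exact (contDiffAt_lieChartMul (mem_extChartAt_target (1 : G)) (mem_extChartAt_target (1 : G))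
      (by rw [h1, one_mul]; exact mem_chart_source E (1 : G))).of_le
        (mod_cast le_top : ((2 : ℕ∞) : WithTop ℕ∞) ≤ ∞)
  · filter_upwards [ht] with y hy
    rw [lieChartMul, h1, one_mul]
    exact (extChartAt 𝓘(ℝ, E) (1 : G)).right_inv hy
  · filter_upwards [ht] with y hy
    rw [lieChartMul, h1, mul_one]
    exact (extChartAt 𝓘(ℝ, E) (1 : G)).right_inv hy
  · filter_upwards [ht] with x hx
    refine (fderiv_lieChartMul_right hx w).trans (Eq.trans ?_ (fderiv_lieChartMul_left hx _).symm)
    exact congrArg (mfderiv 𝓘(ℝ, E) 𝓘(ℝ, E) (extChartAt 𝓘(ℝ, E) (1 : G))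
      ((extChartAt 𝓘(ℝ, E) (1 : G)).symm x))
      (mfderiv_mul_left_eq_mfderiv_mul_right_lieAd (E := E) _ w)

end LieGroupChart

/-! ### Linear flows -/

section LinearFlow

variable {W : Type*} [NormedAddCommGroup W] [NormedSpace ℝ W]

/-- The flow of the linear vector field `N`. -/
noncomputable def linFlow (N : W →L[ℝ] W) (t : ℝ) : W →L[ℝ] W := NormedSpace.exp (t • N)

variable (N : W →L[ℝ] W)

@[simp]
theorem linFlow_zero (x : W) : linFlow N 0 x = x := by
  simp [linFlow]

variable [CompleteSpace W]

theorem linFlow_add (s t : ℝ) (x : W) : linFlow N (s + t) x = linFlow N s (linFlow N t x) := by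
  let _ : NormedAlgebra ℚ (W →L[ℝ] W) := NormedAlgebra.restrictScalars ℚ ℝ _
  have hc : Commute (s • N) (t • N) := ((Commute.refl N).smul_left s).smul_right t
  simp only [linFlow, add_smul]
  rw [NormedSpace.exp_add_of_commute hc]
  rfl

theorem linFlow_neg_linFlow (t : ℝ) (x : W) : linFlow N (-t) (linFlow N t x) = x := by
  rw [← linFlow_add, neg_add_cancel, linFlow_zero]

theorem linFlow_linFlow_neg (t : ℝ) (x : W) : linFlow N t (linFlow N (-t) x) = x := by
  rw [← linFlow_add, add_neg_cancel, linFlow_zero]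

theorem linFlow_injective (t : ℝ) : Function.Injective (linFlow N t) :=
  Function.LeftInverse.injective (linFlow_neg_linFlow N t)

theorem hasDerivAt_linFlow_clm (t : ℝ) : HasDerivAt (linFlow N) (N * linFlow N t) t :=
  hasDerivAt_exp_smul_const' N t

/-- The derivative of exp(tN) can be written with N on either side, and derivatives are unique. -/
theorem apply_linFlow (t : ℝ) (x : W) : N (linFlow N t x) = linFlow N t (N x) :=
  DFunLike.congr_fun
    ((hasDerivAt_linFlow_clm N t).unique (hasDerivAt_exp_smul_const N t)) x

theorem hasDerivAt_linFlow (t : ℝ) (x : W) :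
    HasDerivAt (fun t => linFlow N t x) (N (linFlow N t x)) t := by
  simpa using (hasDerivAt_linFlow_clm N t).clm_apply (hasDerivAt_const t x)

theorem contDiff_linFlow_clm : ContDiff ℝ ∞ (linFlow N) := by
  have h : ContDiff ℝ ∞ (NormedSpace.exp : (W →L[ℝ] W) → (W →L[ℝ] W)) :=
    contDiff_iff_contDiffAt.2 fun x => (NormedSpace.exp_analytic (𝕂 := ℝ) x).contDiffAt
  exact h.comp (contDiff_id.smul contDiff_const)

theorem continuous_linFlow (x : W) : Continuous fun t => linFlow N t x :=
  continuous_iff_continuousAt.2 fun t => (hasDerivAt_linFlow N t x).continuousAt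

theorem linFlow_eq_self {e : W} (he : N e = 0) (t : ℝ) : linFlow N t e = e := by
  have h := is_const_of_deriv_eq_zero (f := fun t => linFlow N t e)
    (fun t => (hasDerivAt_linFlow N t e).differentiableAt)
    (fun t => by rw [(hasDerivAt_linFlow N t e).deriv, apply_linFlow, he, map_zero]) t 0
  simpa using h

theorem apply_linFlow_of_comp_eq_zero {ε : W →L[ℝ] ℝ} (hε : ∀ x, ε (N x) = 0) (t : ℝ) (x : W) :
    ε (linFlow N t x) = ε x := by
  have hd : ∀ t, HasDerivAt (fun t => ε (linFlow N t x)) 0 t := fun t => by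
    have := ε.hasFDerivAt.comp_hasDerivAt t (hasDerivAt_linFlow N t x)
    rwa [hε] at this
  have h := is_const_of_deriv_eq_zero (f := fun t => ε (linFlow N t x))
    (fun t => (hd t).differentiableAt) (fun t => (hd t).deriv) t 0
  simpa using h

theorem hasDerivAt_linFlow_comp {σ : ℝ → ℝ} {x : ℝ → W} {σ' : ℝ} {x' : W} {s : ℝ}
    (hσ : HasDerivAt σ σ' s) (hx : HasDerivAt x x' s) :
    HasDerivAt (fun s => linFlow N (σ s) (x s))
      (σ' • N (linFlow N (σ s) (x s)) + linFlow N (σ s) x') s := by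
  have h1 := (hasDerivAt_linFlow_clm N (σ s)).scomp s hσ
  simpa using h1.clm_apply hx

/-- Solutions of the linear equation `y' = N y` are given by the flow of `N`. -/
theorem eq_linFlow_of_hasDerivAt {y : ℝ → W} {r : ℝ}
    (hy : ∀ s ∈ Set.Ioo (-r) r, HasDerivAt y (N (y s)) s) {t : ℝ} (ht : t ∈ Set.Ioo (-r) r) :
    y t = linFlow N t (y 0) := by
  have h0 : (0 : ℝ) ∈ Set.Ioo (-r) r := by
    have := ht.1.trans ht.2
    constructor <;> linarith
  -- Undoing the flow along a solution leaves a constant.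
  have hd : ∀ s ∈ Set.Ioo (-r) r, HasDerivAt (fun s => linFlow N (-s) (y s)) 0 s := fun s hs => by
    have h := hasDerivAt_linFlow_comp N (hasDerivAt_id s).neg (hy s hs)
    simpa [apply_linFlow] using h
  have h := isOpen_Ioo.is_const_of_deriv_eq_zero isPreconnected_Ioo
    (fun s hs => (hd s hs).differentiableAt.differentiableWithinAt)
    (fun s hs => (hd s hs).deriv) ht h0
  simp only [neg_zero, linFlow_zero] at h
  rw [← h, linFlow_linFlow_neg]

/-- The exponential series stops after its linear term. This is how translations along `e` arise as
flows of coadjoint generators. -/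
theorem linFlow_of_apply_apply_eq_zero {x : W} (hx : N (N x) = 0) (t : ℝ) :
    linFlow N t x = x + t • N x := by
  have h := eq_linFlow_of_hasDerivAt N (y := fun s => x + s • N x) (r := |t| + 1)
    (fun s _ => by simpa [hx] using ((hasDerivAt_id s).smul_const (N x)).const_add x)
    (t := t) ⟨by linarith [neg_abs_le t], by linarith [le_abs_self t]⟩
  simpa using h.symm

theorem linFlow_nsmul (n : ℕ) (t : ℝ) (x : W) : linFlow N (n * t) x = (linFlow N t)^[n] x := by
  induction n with
  | zero => simp
  | succ n ih =>
    rw [Function.iterate_succ_apply', ← ih, ← linFlow_add]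
    congr 2
    push_cast
    ring

end LinearFlow

/-! ### The foliation by the orbits of a linear flow and of a translation flow -/

section SplitFlow

variable {W : Type*} [NormedAddCommGroup W] [NormedSpace ℝ W]

/-- The linear vector field `N` and the constant vector field `e` commute, and are transverse to
each other: `N` takes values in the kernel of a linear form `ε` with `ε e = 1`. -/
structure IsSplitFlow (N : W →L[ℝ] W) (e : W) (ε : W →L[ℝ] ℝ) : Prop where
  apply_vector : N e = 0
  form_vector : ε e = 1
  form_apply : ∀ x, ε (N x) = 0

/-- The orbit of `x` under the flows of the linear vector field `N` and of the constant vector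
field `e`. -/
def splitOrbit (N : W →L[ℝ] W) (e x : W) : Set W :=
  Set.range fun p : ℝ × ℝ => linFlow N p.1 x + p.2 • e

/-- The tangent spaces of the orbits. -/
def splitTangent (N : W →L[ℝ] W) (e x : W) : Submodule ℝ W := Submodule.span ℝ {e, N x}

variable {N : W →L[ℝ] W} {e : W} {ε : W →L[ℝ] ℝ}

theorem mem_splitTangent {x v : W} :
    v ∈ splitTangent N e x ↔ ∃ a b : ℝ, a • e + b • N x = v :=
  Submodule.mem_span_pair

theorem self_mem_splitOrbit (x : W) : x ∈ splitOrbit N e x := ⟨(0, 0), by simp⟩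

namespace IsSplitFlow

theorem linearIndependent (h : IsSplitFlow N e ε) {x : W} (hx : N x ≠ 0) :
    LinearIndependent ℝ ![e, N x] := by
  rw [LinearIndependent.pair_iff]
  intro a b hab
  have ha : a = 0 := by
    have := congrArg ε hab
    simpa [h.form_vector, h.form_apply] using this
  subst ha
  refine ⟨rfl, ?_⟩
  simpa [hx] using hab

/-- A norming form for `N x` is corrected by a multiple of `ε`, which does not change it on the
image of `N`. The result reads off the `N`-component of a tangent vector. -/
theorem exists_form (h : IsSplitFlow N e ε) {x : W} (hx : N x ≠ 0) :
    ∃ ℓ : W →L[ℝ] ℝ, ℓ e = 0 ∧ ℓ (N x) ≠ 0 := by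
  obtain ⟨g, -, hg⟩ := exists_dual_vector ℝ (N x) (norm_ne_zero_iff.2 hx)
  refine ⟨g - g e • ε, ?_, ?_⟩
  · simp [h.form_vector]
  · simpa [h.form_apply, hg] using hx

variable [CompleteSpace W]

theorem mem_splitOrbit_trans (h : IsSplitFlow N e ε) {x y z : W} (hy : y ∈ splitOrbit N e x)
    (hz : z ∈ splitOrbit N e y) : z ∈ splitOrbit N e x := by
  obtain ⟨⟨t, b⟩, rfl⟩ := hy
  obtain ⟨⟨s, c⟩, rfl⟩ := hz
  refine ⟨(s + t, b + c), ?_⟩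
  simp only [map_add, map_smul, linFlow_eq_self N h.apply_vector, linFlow_add, add_smul]
  abel

theorem mem_splitOrbit_symm (h : IsSplitFlow N e ε) {x y : W} (hy : y ∈ splitOrbit N e x) :
    x ∈ splitOrbit N e y := by
  obtain ⟨⟨t, b⟩, rfl⟩ := hy
  refine ⟨(-t, -b), ?_⟩
  simp [linFlow_eq_self N h.apply_vector, linFlow_neg_linFlow]

theorem apply_ne_zero_of_mem_splitOrbit (h : IsSplitFlow N e ε) {x y : W}
    (hy : y ∈ splitOrbit N e x) (hx : N x ≠ 0) : N y ≠ 0 := by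
  obtain ⟨⟨t, b⟩, rfl⟩ := hy
  simpa [h.apply_vector, apply_linFlow] using
    (map_ne_zero_iff _ (linFlow_injective N t)).2 hx

/-- A curve which is tangent to the orbits stays in one orbit. -/
theorem mem_splitOrbit_of_hasDerivAt (h : IsSplitFlow N e ε) {x x' : ℝ → W} {ℓ : W →L[ℝ] ℝ}
    (hx : ∀ s ∈ Set.Icc (0 : ℝ) 1, HasDerivAt x (x' s) s) (hx' : ContinuousOn x' (Set.Icc 0 1))
    (ht : ∀ s ∈ Set.Icc (0 : ℝ) 1, x' s ∈ splitTangent N e (x s)) (hle : ℓ e = 0)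
    (hl : ∀ s ∈ Set.Icc (0 : ℝ) 1, ℓ (N (x s)) ≠ 0) : x 1 ∈ splitOrbit N e (x 0) := by
  have hxc : ContinuousOn x (Set.Icc 0 1) := fun s hs => (hx s hs).continuousAt.continuousWithinAt
  have hb : ContinuousOn (fun s => ℓ (x' s) / ℓ (N (x s))) (Set.Icc 0 1) :=
    (ℓ.continuous.comp_continuousOn hx').div
      ((ℓ.continuous.comp N.continuous).comp_continuousOn hxc) hl
  -- The coefficient of `N x` in `x'`, recovered by `ℓ`; it is extended to a continuous function on
  -- the line so that its primitive `τ` is differentiable also at the endpoints.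
  let b : ℝ → ℝ := Set.IccExtend zero_le_one ((Set.Icc (0 : ℝ) 1).domRestrict
    (fun s => ℓ (x' s) / ℓ (N (x s))))
  have hbc : Continuous b := (continuousOn_iff_continuous_domRestrict.1 hb).Icc_extend'
  have hbs : ∀ s ∈ Set.Icc (0 : ℝ) 1, b s = ℓ (x' s) / ℓ (N (x s)) := fun s hs =>
    Set.IccExtend_of_mem _ _ hs
  let τ : ℝ → ℝ := fun s => ∫ r in (0 : ℝ)..s, b r
  have hτ : ∀ s, HasDerivAt τ (b s) s := fun s =>
    intervalIntegral.integral_hasDerivAt_right (hbc.intervalIntegrable _ _)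
      (hbc.stronglyMeasurableAtFilter _ _) hbc.continuousAt
  have hτ0 : τ 0 = 0 := intervalIntegral.integral_same
  -- Undoing the flow for time `τ` and removing the `e`-coordinate cancels both components of `x'`,
  -- so `z` is constant.
  let z : ℝ → W := fun s => linFlow N (-τ s) (x s) - ε (x s) • e
  have hz : ∀ s ∈ Set.Icc (0 : ℝ) 1, HasDerivAt z 0 s := by
    intro s hs
    have h1 := hasDerivAt_linFlow_comp N (hτ s).neg (hx s hs)
    have h2 := (ε.hasFDerivAt.comp_hasDerivAt s (hx s hs)).smul_const e
    have h3 := h1.sub h2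
    obtain ⟨a, c, hac⟩ := mem_splitTangent.1 (ht s hs)
    have hc : b s = c := by
      rw [hbs s hs, ← hac]
      simp [hle, hl s hs]
    refine HasDerivAt.congr_deriv (f := z) h3 ?_
    rw [← hac, hc]
    simp [linFlow_eq_self N h.apply_vector, h.form_apply, h.form_vector, apply_linFlow]
  have hconst := constant_of_has_deriv_right_zero
    (fun s hs => (hz s hs).continuousAt.continuousWithinAt)
    (fun s hs => (hz s ⟨hs.1, hs.2.le⟩).hasDerivWithinAt) 1 ⟨zero_le_one, le_rfl⟩
  simp only [z, hτ0, neg_zero, linFlow_zero] at hconst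
  refine ⟨(τ 1, ε (x 1) - ε (x 0)), ?_⟩
  have h4 := congrArg (linFlow N (τ 1)) hconst
  simp only [map_sub, map_smul, linFlow_linFlow_neg, linFlow_eq_self N h.apply_vector] at h4
  simp only [sub_smul]
  rw [sub_eq_iff_eq_add] at h4
  exact Eq.trans (by abel) h4.symm

section Manifold

variable {d : Type*} [NormedAddCommGroup d] [NormedSpace ℝ d]
  {M : Type*} [TopologicalSpace M] [ChartedSpace d M]

/-- A smooth map which is tangent to the orbits takes values locally in one orbit. -/
theorem eventually_mem_splitOrbit (h : IsSplitFlow N e ε) [IsManifold 𝓘(ℝ, d) ∞ M] {f : M → W}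
    (hf : ContMDiff 𝓘(ℝ, d) 𝓘(ℝ, W) ∞ f)
    (ht : ∀ m v, (mfderiv 𝓘(ℝ, d) 𝓘(ℝ, W) f m v : W) ∈ splitTangent N e (f m)) {m : M}
    (hm : N (f m) ≠ 0) : ∀ᶠ m' in 𝓝 m, f m' ∈ splitOrbit N e (f m) := by
  have : IsManifold 𝓘(ℝ, d) 1 M := .of_le (n := ∞) (by simp)
  obtain ⟨ℓ, hle, hl⟩ := h.exists_form hm
  set φ := extChartAt 𝓘(ℝ, d) m with hφ
  let ξ : d → W := f ∘ φ.symm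
  have hξ : ∀ u ∈ φ.target, ContDiffAt ℝ ∞ ξ u := fun u hu =>
    contMDiffAt_iff_contDiffAt.1
      (hf.contMDiffAt.comp u (contMDiffAt_extChartAt_symm_of_mem hu))
  have hξm : ξ (φ m) = f m := congrArg f (extChartAt_to_inv m)
  have hξt : ∀ u ∈ φ.target, ∀ v, fderiv ℝ ξ u v ∈ splitTangent N e (ξ u) := by
    intro u hu v
    have key := mfderiv_comp u (hf.mdifferentiableAt (x := φ.symm u) (by simp))
      ((contMDiffAt_extChartAt_symm_of_mem hu).mdifferentiableAt (by simp))
    have h2 := ht (φ.symm u) (mfderiv 𝓘(ℝ, d) 𝓘(ℝ, d) φ.symm u v)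
    rw [← mfderiv_eq_fderiv]
    exact (congrArg (· ∈ splitTangent N e (ξ u)) (DFunLike.congr_fun key v)).mpr h2
  -- On a chart ball where `ℓ ∘ N` has no zero, the result on curves applies to the segments from
  -- the centre.
  have hopen : ∀ᶠ u in 𝓝 (φ m), u ∈ φ.target ∧ ℓ (N (ξ u)) ≠ 0 := by
    refine Filter.Eventually.and (extChartAt_target_mem_nhds (I := 𝓘(ℝ, d)) m) ?_
    have hc : ContinuousAt (fun u => ℓ (N (ξ u))) (φ m) :=
      ((ℓ.continuous.comp N.continuous).continuousAt).comp
        (hξ _ (mem_extChartAt_target m)).continuousAt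
    exact hc.eventually_ne (by rw [hξm]; exact hl)
  obtain ⟨r, hr, hball⟩ := Metric.eventually_nhds_iff_ball.1 hopen
  have hloc : ∀ u ∈ Metric.ball (φ m) r, ξ u ∈ splitOrbit N e (f m) := by
    intro u hu
    have hseg : ∀ s ∈ Set.Icc (0 : ℝ) 1, φ m + s • (u - φ m) ∈ Metric.ball (φ m) r := by
      intro s hs
      exact (convex_ball (φ m) r).add_smul_sub_mem (Metric.mem_ball_self hr) hu hs
    have hcurve : ∀ s : ℝ, HasDerivAt (fun s : ℝ => φ m + s • (u - φ m)) (u - φ m) s := fun s => by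
      simpa using ((hasDerivAt_id s).smul_const (u - φ m)).const_add (φ m)
    have key := h.mem_splitOrbit_of_hasDerivAt (x := fun s => ξ (φ m + s • (u - φ m)))
      (x' := fun s => fderiv ℝ ξ (φ m + s • (u - φ m)) (u - φ m)) (ℓ := ℓ)
      (fun s hs => ((hξ _ (hball _ (hseg s hs)).1).differentiableAt
        (by simp)).hasFDerivAt.comp_hasDerivAt s (hcurve s))
      (fun s hs => by
        have h1 : ContinuousAt (fderiv ℝ ξ) (φ m + s • (u - φ m)) :=
          ((hξ _ (hball _ (hseg s hs)).1).fderiv_right (m := 0) (by simp)).continuousAt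
        have h2 : ContinuousAt (fun s : ℝ => fderiv ℝ ξ (φ m + s • (u - φ m))) s :=
          ContinuousAt.comp (f := fun s : ℝ => φ m + s • (u - φ m)) h1 (hcurve s).continuousAt
        exact (h2.clm_apply continuousAt_const).continuousWithinAt)
      (fun s hs => hξt _ (hball _ (hseg s hs)).1 _) hle
      (fun s hs => (hball _ (hseg s hs)).2)
    simpa [hξm] using key
  filter_upwards [(continuousAt_extChartAt (I := 𝓘(ℝ, d)) m).preimage_mem_nhds
      (Metric.ball_mem_nhds _ hr), extChartAt_source_mem_nhds (I := 𝓘(ℝ, d)) m] with m' h1 h2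
  have := hloc _ h1
  rwa [show ξ (φ m') = f m' from congrArg f (φ.left_inv h2)] at this

/-- A smooth map from a connected manifold which is tangent to the orbits takes values in one
orbit. -/
theorem mem_splitOrbit_of_connected (h : IsSplitFlow N e ε) [IsManifold 𝓘(ℝ, d) ∞ M]
    [PreconnectedSpace M] {f : M → W} (hf : ContMDiff 𝓘(ℝ, d) 𝓘(ℝ, W) ∞ f)
    (ht : ∀ m v, (mfderiv 𝓘(ℝ, d) 𝓘(ℝ, W) f m v : W) ∈ splitTangent N e (f m))
    (hN : ∀ m, N (f m) ≠ 0) (m m' : M) : f m' ∈ splitOrbit N e (f m) := by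
  have hloc := fun m => h.eventually_mem_splitOrbit hf ht (hN m)
  -- Orbits partition the space, so local constancy of the orbit makes both this set and its
  -- complement open.
  have hclopen : IsClopen {m' | f m' ∈ splitOrbit N e (f m)} := by
    refine ⟨isOpen_compl_iff.1 (isOpen_iff_mem_nhds.2 fun m₁ h₁ => ?_),
      isOpen_iff_mem_nhds.2 fun m₁ h₁ => ?_⟩
    · filter_upwards [hloc m₁] with m₂ h₂ h₃
      exact h₁ (h.mem_splitOrbit_trans h₃ (h.mem_splitOrbit_symm h₂))
    · filter_upwards [hloc m₁] with m₂ h₂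
      exact h.mem_splitOrbit_trans h₁ h₂
  have := hclopen.eq_univ ⟨m, self_mem_splitOrbit (f m)⟩
  exact (Set.ext_iff.1 this m').2 (Set.mem_univ m')

end Manifold

end IsSplitFlow

end SplitFlow

/-! ### Integral manifolds parametrized by open subsets of the model space -/

section OpenSubset

variable {W : Type*} [NormedAddCommGroup W] [NormedSpace ℝ W]

theorem hasMFDerivAt_opens_val {k : ℕ} {U : TopologicalSpace.Opens (EuclideanSpace ℝ (Fin k))}
    (m : U) : HasMFDerivAt (𝓡 k) (𝓡 k) (Subtype.val : U → EuclideanSpace ℝ (Fin k)) m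
      (ContinuousLinearMap.id ℝ (EuclideanSpace ℝ (Fin k))) := by
  refine ⟨continuous_subtype_val.continuousAt, ?_⟩
  refine HasFDerivAt.hasFDerivWithinAt (HasFDerivAt.congr_of_eventuallyEq (hasFDerivAt_id _) ?_)
  filter_upwards [extChartAt_target_mem_nhds (I := 𝓡 k) m] with y hy
  exact (extChartAt (𝓡 k) m).right_inv hy

/-- An injective immersion of an open subset of the model space presents an integral manifold. -/
theorem isConnectedIntegralManifold_image {k : ℕ}
    {U : TopologicalSpace.Opens (EuclideanSpace ℝ (Fin k))}
    (hU : IsConnected (U : Set (EuclideanSpace ℝ (Fin k))))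
    {f : EuclideanSpace ℝ (Fin k) → W} {V : Set W} {P : W → Submodule ℝ W}
    (hf : ∀ x ∈ U, ContDiffAt ℝ ∞ f x) (hinj : Set.InjOn f U) (hV : ∀ x ∈ U, f x ∈ V)
    (hd : ∀ x ∈ U, Function.Injective (fderiv ℝ f x))
    (hP : ∀ x ∈ U, LinearMap.range (fderiv ℝ f x).toLinearMap = P (f x)) :
    IsConnectedIntegralManifold k V P (f '' U) := by
  have hder : ∀ m : U, mfderiv (𝓡 k) 𝓘(ℝ, W) (fun m : U => f m) m =
      fderiv ℝ f (m : EuclideanSpace ℝ (Fin k)) := fun m => by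
    have h1 : HasMFDerivAt (𝓡 k) 𝓘(ℝ, W) f (m : EuclideanSpace ℝ (Fin k))
        (fderiv ℝ f (m : EuclideanSpace ℝ (Fin k))) :=
      ((hf m m.2).differentiableAt (by simp)).hasFDerivAt.hasMFDerivAt
    exact (h1.comp m (hasMFDerivAt_opens_val m)).mfderiv
  refine ⟨U, inferInstance, inferInstance, fun m => f m, isConnected_iff_connectedSpace.1 hU,
    ⟨inferInstance, inferInstance, inferInstance, fun m => ?_, fun m m' h => ?_, fun m => ?_⟩,
    ?_, ?_, fun m => ?_⟩
  · exact (contMDiffAt_iff_contDiffAt.2 (hf m m.2)).comp m contMDiff_subtype_val.contMDiffAt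
  · exact Subtype.ext (hinj m.2 m'.2 h)
  · rw [hder]
    exact hd m m.2
  · ext y; simp
  · rintro _ ⟨x, hx, rfl⟩
    exact hV x hx
  · rw [submanifoldTangent, hder]
    exact hP m m.2

end OpenSubset

/-! ### The orbits as leaves -/

section SplitFoliation

variable {W : Type*} [NormedAddCommGroup W] [NormedSpace ℝ W]
  {N : W →L[ℝ] W} {e : W} {ε : W →L[ℝ] ℝ}

theorem hasFDerivAt_linFlow_add [CompleteSpace W] (N : W →L[ℝ] W) (e x : W) (c : ℝ) (w : ℂ) :
    HasFDerivAt (fun w : ℂ => linFlow N (c * w.im) x + w.re • e)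
      ((c • Complex.imCLM).smulRight (N (linFlow N (c * w.im) x)) +
        Complex.reCLM.smulRight e) w := by
  have h1 : HasFDerivAt (fun w : ℂ => c * w.im) (c • Complex.imCLM) w :=
    (c • Complex.imCLM).hasFDerivAt
  have h2 : HasFDerivAt (fun w : ℂ => w.re • e) (Complex.reCLM.smulRight e) w :=
    (Complex.reCLM.smulRight e).hasFDerivAt
  have h3 := (hasDerivAt_linFlow N (c * w.im) x).hasFDerivAt.comp w h1
  convert! h3.add h2 using 1

theorem contDiff_linFlow_add [CompleteSpace W] (N : W →L[ℝ] W) (e x : W) (c : ℝ) :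
    ContDiff ℝ ∞ (fun w : ℂ => linFlow N (c * w.im) x + w.re • e) := by
  have h1 : ContDiff ℝ ∞ (fun w : ℂ => c * w.im) := (c • Complex.imCLM).contDiff
  have h2 : ContDiff ℝ ∞ (fun w : ℂ => w.re • e) := (Complex.reCLM.smulRight e).contDiff
  exact (((contDiff_linFlow_clm N).comp h1).clm_apply contDiff_const).add h2

/-- The identification of `ℂ` with the Euclidean plane. -/
noncomputable def planeEquiv : EuclideanSpace ℝ (Fin 2) ≃L[ℝ] ℂ :=
  Complex.orthonormalBasisOneI.repr.symm.toContinuousLinearEquiv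

namespace IsSplitFlow

theorem smul_add_smul_injective (h : IsSplitFlow N e ε) {x : W} (hx : N x ≠ 0) {a b a' b' : ℝ}
    (hab : a • e + b • N x = a' • e + b' • N x) : a = a' ∧ b = b' := by
  have := LinearIndependent.pair_iff.1 (h.linearIndependent hx) (a - a') (b - b') (by
    rw [sub_smul, sub_smul, ← sub_eq_zero.2 hab]; abel)
  exact ⟨sub_eq_zero.1 this.1, sub_eq_zero.1 this.2⟩

/-- Parametrizations of an orbit by an open subset `U` of `ℂ` on which a logarithm is used as a
local coordinate. -/
theorem isConnectedIntegralManifold_of_param (h : IsSplitFlow N e ε) {U : Set ℂ} (hUo : IsOpen U)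
    (hU : IsConnected U) {f : ℂ → W} {L : Set W} (hL : f '' U = L) (hinj : Set.InjOn f U)
    (hV : ∀ z ∈ U, N (f z) ≠ 0) (hf : ∀ z ∈ U, ContDiffAt ℝ ∞ f z)
    (hd : ∀ z ∈ U, ∃ a : ℂ, ∃ c : ℝ, a ≠ 0 ∧ c ≠ 0 ∧
      ∀ v, fderiv ℝ f z v = (a * v).re • e + (c * (a * v).im) • N (f z)) :
    IsConnectedIntegralManifold 2 {x | N x ≠ 0} (splitTangent N e) L := by
  let U' : TopologicalSpace.Opens (EuclideanSpace ℝ (Fin 2)) :=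
    ⟨planeEquiv ⁻¹' U, hUo.preimage planeEquiv.continuous⟩
  have hU' : IsConnected (U' : Set (EuclideanSpace ℝ (Fin 2))) := by
    have : (U' : Set (EuclideanSpace ℝ (Fin 2))) = planeEquiv.symm '' U :=
      (planeEquiv.symm.image_eq_preimage_symm U).symm
    rw [this]
    exact hU.image _ planeEquiv.symm.continuous.continuousOn
  have hder : ∀ p ∈ U', ∀ v, fderiv ℝ (f ∘ planeEquiv) p v =
      fderiv ℝ f (planeEquiv p) (planeEquiv v) := fun p hp v => by
    have h1 := ((hf _ hp).differentiableAt (by simp)).hasFDerivAt.comp p planeEquiv.hasFDerivAt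
    rw [h1.fderiv]
    rfl
  have key := isConnectedIntegralManifold_image (V := {x | N x ≠ 0}) (P := splitTangent N e) hU'
    (f := f ∘ planeEquiv)
    (fun p hp => (hf _ hp).comp p planeEquiv.contDiff.contDiffAt)
    (fun p hp q hq hpq => planeEquiv.injective (hinj hp hq hpq))
    (fun p hp => hV _ hp)
    (fun p hp v w hvw => by
      rw [hder p hp, hder p hp] at hvw
      obtain ⟨a, c, ha, hc, hv⟩ := hd _ hp
      rw [hv, hv] at hvw
      obtain ⟨h1, h2⟩ := h.smul_add_smul_injective (hV _ hp) hvw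
      exact planeEquiv.injective
        (mul_left_cancel₀ ha (Complex.ext h1 (mul_left_cancel₀ hc h2))))
    (fun p hp => by
      obtain ⟨a, c, ha, hc, hv⟩ := hd _ hp
      ext w
      rw [mem_splitTangent, LinearMap.mem_range]
      constructor
      · rintro ⟨v, rfl⟩
        exact ⟨_, _, ((hder p hp v).trans (hv _)).symm⟩
      · rintro ⟨s, t, rfl⟩
        refine ⟨planeEquiv.symm (a⁻¹ * ⟨s, c⁻¹ * t⟩), (hder p hp _).trans ?_⟩
        rw [hv, ContinuousLinearEquiv.apply_symm_apply, mul_inv_cancel_left₀ ha]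
        simp [hc])
  have himage : (f ∘ planeEquiv) '' (U' : Set (EuclideanSpace ℝ (Fin 2))) = L := by
    rw [← hL, Set.image_comp]
    congr 1
    exact Set.image_preimage_eq U planeEquiv.surjective
  rwa [himage] at key

variable [CompleteSpace W]

/-- The stabilizer of `x` under the flow of `N`. -/
def flowStabilizer (N : W →L[ℝ] W) (x : W) : AddSubgroup ℝ where
  carrier := {t | linFlow N t x = x}
  add_mem' {s t} hs ht := by
    simp only [Set.mem_ofPred_eq] at hs ht ⊢
    rw [linFlow_add, ht, hs]
  zero_mem' := linFlow_zero N x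
  neg_mem' {t} ht := by
    simp only [Set.mem_ofPred_eq] at ht ⊢
    nth_rw 1 [← ht]
    exact linFlow_neg_linFlow N t x

/-- A subgroup of ℝ is dense or cyclic. A dense stabilizer, being closed, would be all of ℝ and make
the flow line constant, against `N x ≠ 0`. The value `T = 0` means a trivial stabilizer. -/
theorem exists_flowStabilizer_eq {x : W} (hx : N x ≠ 0) :
    ∃ T : ℝ, ∀ t, linFlow N t x = x ↔ ∃ n : ℤ, t = n * T := by
  rcases (flowStabilizer N x).dense_or_cyclic with hdense | ⟨T, hT⟩
  · exfalso
    have hcl : IsClosed (flowStabilizer N x : Set ℝ) :=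
      isClosed_eq (continuous_linFlow N x) continuous_const
    have huniv : (flowStabilizer N x : Set ℝ) = Set.univ := by
      rw [← hcl.closure_eq, hdense.closure_eq]
    have hconst : (fun t => linFlow N t x) = fun _ => x :=
      funext fun t => (Set.ext_iff.1 huniv t).2 trivial
    have hd := hasDerivAt_linFlow N 0 x
    rw [hconst, linFlow_zero] at hd
    exact hx (hd.unique (hasDerivAt_const 0 x))
  · refine ⟨T, fun t => ?_⟩
    have : linFlow N t x = x ↔ t ∈ flowStabilizer N x := Iff.rfl
    rw [this, hT, AddSubgroup.mem_closure_singleton]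
    simp [eq_comm]

theorem linFlow_eq_linFlow_iff {x : W} {s t : ℝ} :
    linFlow N s x = linFlow N t x ↔ linFlow N (s - t) x = x := by
  rw [← (linFlow_injective N t).eq_iff (a := linFlow N (s - t) x), ← linFlow_add,
    add_sub_cancel]

/-- The orbits are connected integral manifolds. -/
theorem isConnectedIntegralManifold_splitOrbit (h : IsSplitFlow N e ε) {x : W} (hx : N x ≠ 0) :
    IsConnectedIntegralManifold 2 {x | N x ≠ 0} (splitTangent N e) (splitOrbit N e x) := by
  obtain ⟨T, hT⟩ := exists_flowStabilizer_eq hx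
  have hmem : ∀ (c : ℝ) (w : ℂ), linFlow N (c * w.im) x + w.re • e ∈ splitOrbit N e x :=
    fun c w => ⟨(c * w.im, w.re), rfl⟩
  have hN : ∀ (c : ℝ) (w : ℂ), N (linFlow N (c * w.im) x + w.re • e) =
      N (linFlow N (c * w.im) x) := fun c w => by simp [h.apply_vector]
  have hform : ∀ (c : ℝ) (w : ℂ), ε (linFlow N (c * w.im) x + w.re • e) = ε x + w.re :=
    fun c w => by
      simp [apply_linFlow_of_comp_eq_zero N h.form_apply, h.form_vector]
  have hsep : ∀ {c : ℝ} {w w' : ℂ}, linFlow N (c * w.im) x + w.re • e =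
      linFlow N (c * w'.im) x + w'.re • e →
        w.re = w'.re ∧ ∃ n : ℤ, c * w.im - c * w'.im = n * T := by
    intro c w w' hw
    have hre : w.re = w'.re := by
      have := congrArg ε hw
      rw [hform, hform] at this
      exact add_left_cancel this
    rw [hre] at hw
    exact ⟨hre, (hT _).1 (linFlow_eq_linFlow_iff.1 (add_right_cancel hw))⟩
  -- With trivial stabilizer the orbit is a plane with coordinates `w.re` (translation) and `w.im`
  -- (time).
  by_cases hT0 : T = 0
  · refine h.isConnectedIntegralManifold_of_param isOpen_univ isConnected_univ
      (f := fun w : ℂ => linFlow N (1 * w.im) x + w.re • e) ?_ ?_ ?_ ?_ ?_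
    · ext y
      simp only [Set.image_univ, Set.mem_range]
      constructor
      · rintro ⟨w, rfl⟩
        exact hmem 1 w
      · rintro ⟨⟨t, b⟩, rfl⟩
        exact ⟨⟨b, t⟩, by simp⟩
    · intro w _ w' _ hw
      obtain ⟨h1, n, hn⟩ := hsep hw
      rw [hT0] at hn
      exact Complex.ext h1 (by linarith)
    · exact fun w _ => h.apply_ne_zero_of_mem_splitOrbit (hmem 1 w) hx
    · exact fun w _ => (contDiff_linFlow_add N e x 1).contDiffAt
    · intro w _
      refine ⟨1, 1, one_ne_zero, one_ne_zero, fun v => ?_⟩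
      rw [(hasFDerivAt_linFlow_add N e x 1 w).fderiv, hN]
      simp [add_comm]
  -- Otherwise the orbit is a cylinder, parametrized by ℂ∖{0} through z = exp w. The factor `c`
  -- makes a turn of 2π in `w.im` last exactly one period `T`.
  · set c : ℝ := T / (2 * Real.pi) with hc
    have hpi : (2 * Real.pi) ≠ 0 := by positivity
    have hc0 : c ≠ 0 := div_ne_zero hT0 hpi
    have hcT : c * (2 * Real.pi) = T := div_mul_cancel₀ T hpi
    have hper : ∀ w w' : ℂ, Complex.exp w = Complex.exp w' →
        linFlow N (c * w.im) x + w.re • e = linFlow N (c * w'.im) x + w'.re • e := by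
      intro w w' hw
      obtain ⟨n, rfl⟩ := Complex.exp_eq_exp_iff_exists_int.1 hw
      have h1 : linFlow N (c * (w' + n * (2 * Real.pi * Complex.I)).im) x =
          linFlow N (c * w'.im) x := by
        rw [linFlow_eq_linFlow_iff, hT]
        refine ⟨n, ?_⟩
        rw [← hcT]
        simp
        ring
      rw [h1]
      simp
    -- Smooth local logarithms: the principal one off its cut, and log(-z) + πi near the negative
    -- axis. By `hper` the choice of logarithm does not affect the parametrization.
    have hlocal : ∀ z : ℂ, z ≠ 0 → ∃ l : ℂ → ℂ, (∀ z', z' ≠ 0 → Complex.exp (l z') = z') ∧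
        ContDiffAt ℝ ∞ l z ∧ HasDerivAt l z⁻¹ z := by
      intro z hz
      by_cases hs : z ∈ Complex.slitPlane
      · exact ⟨Complex.log, fun z' hz' => Complex.exp_log hz',
          (Complex.contDiffAt_log hs).restrict_scalars ℝ, Complex.hasDerivAt_log hs⟩
      · have hs' : -z ∈ Complex.slitPlane := by
          rw [Complex.mem_slitPlane_iff] at hs ⊢
          push Not at hs
          left
          have : z.re ≠ 0 := fun h0 => hz (Complex.ext h0 hs.2)
          have := lt_of_le_of_ne hs.1 this
          simpa using this
        refine ⟨fun z => Complex.log (-z) + Real.pi * Complex.I, fun z' hz' => ?_, ?_, ?_⟩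
        · rw [Complex.exp_add, Complex.exp_log (neg_ne_zero.2 hz'), Complex.exp_pi_mul_I]
          ring
        · exact (ContDiffAt.comp z ((Complex.contDiffAt_log hs').restrict_scalars ℝ)
            contDiff_neg.contDiffAt).add contDiffAt_const
        · have := ((Complex.hasDerivAt_log hs').comp z (hasDerivAt_neg z)).add_const
            (Real.pi * Complex.I)
          convert! this using 1
          field_simp
    let f : ℂ → W := fun z =>
      linFlow N (c * (Complex.log z).im) x + (Complex.log z).re • e
    have hfl : ∀ z ≠ 0, ∃ a : ℂ, a ≠ 0 ∧ ContDiffAt ℝ ∞ f z ∧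
        ∀ v, fderiv ℝ f z v = (a * v).re • e + (c * (a * v).im) • N (f z) := by
      intro z hz
      obtain ⟨l, hl, hls, hld⟩ := hlocal z hz
      have hfeq : f =ᶠ[𝓝 z]
          (fun w : ℂ => linFlow N (c * w.im) x + w.re • e) ∘ l := by
        filter_upwards [isOpen_ne.mem_nhds hz] with z' hz'
        exact hper _ _ ((Complex.exp_log hz').trans (hl z' hz').symm)
      refine ⟨z⁻¹, inv_ne_zero hz, ?_, fun v => ?_⟩
      · exact ((contDiff_linFlow_add N e x c).contDiffAt.comp z hls).congr_of_eventuallyEq hfeq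
      · have h1 := (hasFDerivAt_linFlow_add N e x c (l z)).comp z
          (hld.hasFDerivAt.restrictScalars ℝ)
        rw [hfeq.fderiv_eq, h1.fderiv, hfeq.self_of_nhds]
        simp only [Function.comp_apply]
        rw [hN]
        simp [add_comm, mul_comm v]
    refine h.isConnectedIntegralManifold_of_param (U := {0}ᶜ) isOpen_compl_singleton
      (isConnected_compl_singleton_of_one_lt_rank (by simp) 0) (f := f) ?_ ?_ ?_ ?_ ?_
    · ext y
      constructor
      · rintro ⟨w, -, rfl⟩
        exact hmem c _
      · rintro ⟨⟨t, b⟩, rfl⟩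
        refine ⟨Complex.exp ⟨b, c⁻¹ * t⟩, Complex.exp_ne_zero _, ?_⟩
        refine (hper _ _ (Complex.exp_log (Complex.exp_ne_zero ⟨b, c⁻¹ * t⟩))).trans ?_
        simp [hc0]
    · intro z hz z' hz' hzz
      obtain ⟨h1, n, hn⟩ := hsep hzz
      rw [← Complex.exp_log hz, ← Complex.exp_log hz', Complex.exp_eq_exp_iff_exists_int]
      refine ⟨n, Complex.ext (by simpa using h1) ?_⟩
      have : (Complex.log z).im = (Complex.log z').im + n * (2 * Real.pi) := by
        rw [← hcT, ← mul_sub, mul_left_comm] at hn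
        linarith [mul_left_cancel₀ hc0 hn]
      simpa using this
    · exact fun z _ => h.apply_ne_zero_of_mem_splitOrbit (hmem c _) hx
    · exact fun z hz => (hfl z hz).choose_spec.2.1
    · intro z hz
      obtain ⟨a, ha, -, hv⟩ := hfl z hz
      exact ⟨a, c, ha, hc0, hv⟩

/-- A connected integral manifold which meets an orbit is contained in it. -/
theorem subset_splitOrbit (h : IsSplitFlow N e ε) {L : Set W} {x : W}
    (hL : IsConnectedIntegralManifold 2 {x | N x ≠ 0} (splitTangent N e) L) (hx : x ∈ L) :
    L ⊆ splitOrbit N e x := by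
  obtain ⟨M, _, _, ι, hc, hι, rfl, hV, ht⟩ := hL
  have := hι.isManifold
  obtain ⟨m, rfl⟩ := hx
  rintro _ ⟨m', rfl⟩
  refine h.mem_splitOrbit_of_connected hι.smooth (fun m v => ?_) (fun m => hV ⟨m, rfl⟩) m m'
  rw [← ht m]
  exact ⟨v, rfl⟩

/-- Orbits are connected integral manifolds and absorb every connected integral manifold that meets
them, so they are exactly the maximal ones. -/
theorem isLeaf_iff (h : IsSplitFlow N e ε) {L : Set W} :
    IsLeaf 2 {x | N x ≠ 0} (splitTangent N e) L ↔ ∃ x, N x ≠ 0 ∧ L = splitOrbit N e x := by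
  constructor
  · rintro ⟨hL, hmax⟩
    obtain ⟨x, hx⟩ : L.Nonempty := by
      obtain ⟨M, _, _, ι, hc, hι, rfl, hV, ht⟩ := hL
      exact Set.range_nonempty ι
    have hxV : N x ≠ 0 := by
      obtain ⟨M, _, _, ι, hc, hι, rfl, hV, ht⟩ := hL
      exact hV hx
    exact ⟨x, hxV, (hmax _ (h.isConnectedIntegralManifold_splitOrbit hxV)
      (h.subset_splitOrbit hL hx)).symm⟩
  · rintro ⟨x, hx, rfl⟩
    refine ⟨h.isConnectedIntegralManifold_splitOrbit hx, fun L' hL' hsub => ?_⟩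
    exact (h.subset_splitOrbit hL' (hsub (self_mem_splitOrbit x))).antisymm hsub

/-- The orbits of a split flow are the leaves of a foliation. -/
theorem isFoliation (h : IsSplitFlow N e ε) :
    IsFoliation 2 {x | N x ≠ 0} (splitTangent N e)
      {L | ∃ x, N x ≠ 0 ∧ L = splitOrbit N e x} where
  isOpen := isOpen_ne_fun N.continuous continuous_const
  smooth x hx := by
    refine ⟨{x | N x ≠ 0}, isOpen_ne_fun N.continuous continuous_const, hx, subset_rfl,
      ![fun _ => e, fun x => N x], fun i => ?_, fun y hy => ⟨?_, ?_⟩⟩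
    · fin_cases i
      · exact contDiffOn_const
      · exact N.contDiff.contDiffOn
    · convert! h.linearIndependent hy using 1
      ext i
      fin_cases i <;> rfl
    · rw [splitTangent]
      congr 1
      ext v
      simp [eq_comm, or_comm]
  integrable x hx := by
    obtain ⟨M, i1, i2, ι, -, hM⟩ := h.isConnectedIntegralManifold_splitOrbit hx
    exact ⟨_, ⟨M, i1, i2, ι, hM⟩, self_mem_splitOrbit x⟩
  leaves := by
    ext L
    exact h.isLeaf_iff.symm

end IsSplitFlow

end SplitFoliation

/-! ### The tangent 2-vector field -/

section MultivectorField

variable {W : Type*} [NormedAddCommGroup W] [NormedSpace ℝ W]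
  {N : W →L[ℝ] W} {e : W} {ε : W →L[ℝ] ℝ}

/-- The alternating form f ∧ g, a 2 × 2 determinant, is nonzero on the pair. -/
theorem exteriorPower_two_ne_zero {v w : W} (f g : W →ₗ[ℝ] ℝ)
    (hfg : f v * g w - f w * g v ≠ 0) : exteriorPower.ιMulti ℝ 2 ![v, w] ≠ 0 := by
  intro h0
  have key := congrArg (exteriorPower.alternatingMapLinearEquiv
    ((Matrix.detRowAlternating (R := ℝ) (n := Fin 2)).compLinearMap
      (LinearMap.pi ![f, g]))) h0
  rw [exteriorPower.alternatingMapLinearEquiv_apply_ιMulti, map_zero] at key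
  apply hfg
  have hdet : Matrix.det !![f v, g v; f w, g w] = 0 := by
    refine Eq.trans (congrArg Matrix.det (Matrix.ext fun i j => ?_)) key
    fin_cases i <;> fin_cases j <;> rfl
  rw [Matrix.det_fin_two_of] at hdet
  simpa [mul_comm] using hdet

/-- The field e ∧ N x is linear in x, hence smooth. The forms `ε` and the one from `exists_form`
detect that it does not vanish. -/
theorem IsSplitFlow.isTangentMultivectorField [FiniteDimensional ℝ W] (h : IsSplitFlow N e ε) :
    IsTangentMultivectorField 2 {x | N x ≠ 0} (splitTangent N e)
      (fun x => exteriorPower.ιMulti ℝ 2 ![e, N x]) where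
  smooth l := by
    have hup : ∀ w : W, ![e, w] = Function.update ![e, 0] 1 w := fun w => by
      ext i
      fin_cases i <;> simp
    let b : W →ₗ[ℝ] ℝ :=
      { toFun := fun w => l (exteriorPower.ιMulti ℝ 2 ![e, w])
        map_add' := fun w w' => by
          rw [hup (w + w'), AlternatingMap.map_update_add, map_add, ← hup, ← hup]
        map_smul' := fun c w => by
          rw [hup (c • w), AlternatingMap.map_update_smul, map_smul, ← hup]
          rfl }
    exact ((b.toContinuousLinearMap.contDiff).comp N.contDiff).contDiffOn
  tangent x hx := by
    refine ⟨exteriorPower.ιMulti ℝ 2 ![⟨e, mem_splitTangent.2 ⟨1, 0, by simp⟩⟩,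
      ⟨N x, mem_splitTangent.2 ⟨0, 1, by simp⟩⟩], ?_⟩
    rw [exteriorPower.map_apply_ιMulti]
    congr 1
    ext i
    fin_cases i <;> rfl
  ne_zero x hx := by
    obtain ⟨ℓ, hle, hl⟩ := h.exists_form hx
    refine exteriorPower_two_ne_zero ε.toLinearMap ℓ.toLinearMap ?_
    simpa [h.form_vector, hle] using hl

end MultivectorField

/-! ### Transverse measures from counting points on closed leaves -/

section TransverseMeasure

variable {W : Type*} [NormedAddCommGroup W] [NormedSpace ℝ W]
  {F : Type*} [NormedAddCommGroup F] [NormedSpace ℝ F]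
  {N : W →L[ℝ] W} {e : W} {ε : W →L[ℝ] ℝ}

theorem apply_linFlow_of_semiconj [CompleteSpace W] [CompleteSpace F] {q : W →L[ℝ] F}
    {N' : F →L[ℝ] F} (hq : ∀ x, q (N x) = N' (q x)) (t : ℝ) (x : W) :
    q (linFlow N t x) = linFlow N' t (q x) := by
  have h := eq_linFlow_of_hasDerivAt N' (y := fun s => q (linFlow N s x)) (r := |t| + 1)
    (fun s _ => by
      have := q.hasFDerivAt.comp_hasDerivAt s (hasDerivAt_linFlow N s x)
      rwa [hq] at this)
    (t := t) ⟨by linarith [neg_abs_le t], by linarith [le_abs_self t]⟩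
  simpa using h

/-- An immersion which is transverse to the kernel of `q` at a zero of `q` has no other zeros of `q`
nearby. -/
theorem eventually_ne_of_transverse {d : ℕ} {M : Type*} [TopologicalSpace M]
    [ChartedSpace (EuclideanSpace ℝ (Fin d)) M] {ι : M → W}
    {q : W →L[ℝ] F} {m : M} (hι : MDifferentiableAt (𝓡 d) 𝓘(ℝ, W) ι m)
    (hq : ∀ v, q (mfderiv (𝓡 d) 𝓘(ℝ, W) ι m v) = 0 → v = 0) :
    ∀ᶠ m' in 𝓝[≠] m, q (ι m') ≠ 0 := by
  set φ := extChartAt (𝓡 d) m with hφ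
  let D : EuclideanSpace ℝ (Fin d) →L[ℝ] W := mfderiv (𝓡 d) 𝓘(ℝ, W) ι m
  have hD : HasFDerivAt (ι ∘ φ.symm) D (φ m) := by
    have h := hι.hasMFDerivAt.2
    rw [modelWithCornersSelf_coe, Set.range_id] at h
    exact hasFDerivWithinAt_univ.1 h
  have hqD : HasFDerivAt (q ∘ ι ∘ φ.symm) (q.comp D) (φ m) := q.hasFDerivAt.comp (φ m) hD
  -- An injective linear map on a finite-dimensional space is bounded below, so its first-order term
  -- excludes zeros nearby.
  have hanti : ∃ C, AntilipschitzWith C (q.comp D) := by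
    obtain ⟨C, -, hC⟩ := LinearMap.exists_antilipschitzWith (q.comp D).toLinearMap
      (LinearMap.ker_eq_bot'.2 fun v hv => hq v hv)
    exact ⟨C, hC⟩
  have hne := hqD.eventually_ne (c := 0) hanti
  have hsrc := extChartAt_source_mem_nhds (I := 𝓡 d) m
  have htend : Tendsto φ (𝓝[≠] m) (𝓝[≠] (φ m)) := by
    refine tendsto_nhdsWithin_iff.2
      ⟨(continuousAt_extChartAt (I := 𝓡 d) m).tendsto.mono_left nhdsWithin_le_nhds, ?_⟩
    filter_upwards [self_mem_nhdsWithin, mem_nhdsWithin_of_mem_nhds hsrc] with m' h1 h2 h3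
    exact h1 (φ.injOn h2 (mem_extChartAt_source m) h3)
  filter_upwards [htend.eventually hne, mem_nhdsWithin_of_mem_nhds hsrc] with m' h1 h2
  rwa [Function.comp_apply, Function.comp_apply, φ.left_inv h2] at h1

/-- The counting measure of a closed union of leaves is a transverse measure. -/
theorem isTransverseMeasure_count [CompleteSpace W] [CompleteSpace F]
    [MeasurableSpace W] [BorelSpace W] {q : W →L[ℝ] F} {N' : F →L[ℝ] F}
    (hq : ∀ x, q (N x) = N' (q x)) (hqe : q e = 0)
    (hker : ∀ x, N x ≠ 0 → q x = 0 → ∀ v, q v = 0 → v ∈ splitTangent N e x) :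
    IsTransverseMeasure {x | N x ≠ 0} (splitTangent N e)
      {L | ∃ x, N x ≠ 0 ∧ L = splitOrbit N e x}
      (fun B => MeasureTheory.Measure.count (B ∩ {x | q x = 0})) := by
  have hcl : IsClosed {x | q x = 0} := isClosed_eq q.continuous continuous_const
  -- The zero set of `q` is saturated: `q` ignores translation along `e` and intertwines the flow of
  -- `N` with the invertible flow of `N'`.
  have hsat : ∀ {x y : W}, y ∈ splitOrbit N e x → (q y = 0 ↔ q x = 0) := by
    rintro x _ ⟨⟨t, b⟩, rfl⟩
    simp only [map_add, map_smul, hqe, smul_zero, add_zero, apply_linFlow_of_semiconj hq]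
    exact map_eq_zero_iff _ (linFlow_injective N' t)
  refine ⟨by simp, fun B hB hd => ?_, ?_, ?_⟩
  · rw [Set.iUnion_inter]
    exact MeasureTheory.measure_iUnion
      (fun m n hmn => (hd hmn).mono Set.inter_subset_left Set.inter_subset_left)
      (fun n => (hB n).1.inter hcl.measurableSet)
  · intro B₁ B₂ ψ h₁ h₂ hψ _ hleaf
    have hiff : ∀ x ∈ B₁, q (ψ x) = 0 ↔ q x = 0 := by
      intro x hx
      obtain ⟨L, ⟨y, -, rfl⟩, hxL, hψL⟩ := hleaf x hx
      rw [hsat hxL, hsat hψL]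
    have hbij : Set.BijOn ψ (B₁ ∩ {x | q x = 0}) (B₂ ∩ {x | q x = 0}) := by
      refine ⟨fun x hx => ⟨hψ.mapsTo hx.1, (hiff x hx.1).2 hx.2⟩,
        hψ.injOn.mono Set.inter_subset_left, ?_⟩
      rintro y ⟨hy, hqy⟩
      obtain ⟨x, hx, rfl⟩ := hψ.surjOn hy
      exact ⟨x, ⟨hx, (hiff x hx).1 hqy⟩, rfl⟩
    simp only [MeasureTheory.Measure.count_apply (h₁.1.inter hcl.measurableSet),
      MeasureTheory.Measure.count_apply (h₂.1.inter hcl.measurableSet)]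
    rw [← hbij.image_eq, hbij.injOn.encard_image]
  · intro d M _ _ ι hι hV hcompl K hK
    -- A vector tangent to the transversal and killed by `q` is tangent to the leaf by `hker`, hence
    -- zero by transversality.
    have hiso : ∀ m, q (ι m) = 0 → ∀ᶠ m' in 𝓝[≠] m, q (ι m') ≠ 0 := by
      intro m hm
      refine eventually_ne_of_transverse (hι.smooth.mdifferentiableAt (by simp)) fun v hv => ?_
      have h1 : (mfderiv (𝓡 d) 𝓘(ℝ, W) ι m v : W) ∈ submanifoldTangent d ι m := ⟨v, rfl⟩
      have h2 := hker _ (hV m) hm _ hv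
      have h3 := (Submodule.mem_bot ℝ).1 ((hcompl m).disjoint.le_bot ⟨h1, h2⟩)
      exact hι.immersion m (h3.trans (map_zero _).symm)
    have hclM : IsClosed {m | q (ι m) = 0} := hcl.preimage hι.smooth.continuous
    -- Infinitely many zeros in the compact set would accumulate at a zero, which is isolated.
    have hfin : (K ∩ {m | q (ι m) = 0}).Finite := by
      by_contra hinf
      obtain ⟨m, hm, hacc⟩ := Set.Infinite.exists_accPt_of_subset_isCompact hinf
        (hK.inter_right hclM) subset_rfl
      obtain ⟨m', hm', hne⟩ := ((accPt_iff_frequently_nhdsNE.1 hacc).and_eventually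
        (hiso m hm.2)).exists
      exact hne hm'.2
    have heq : ι '' K ∩ {x | q x = 0} = ι '' (K ∩ {m | q (ι m) = 0}) :=
      (Set.image_inter_preimage ι K {x | q x = 0}).symm
    rw [heq]
    exact (MeasureTheory.Measure.count_apply_lt_top' (hfin.image ι).measurableSet).2 (hfin.image ι)

theorem isMeasurableFoliation_of_comp_eq [CompleteSpace W] [CompleteSpace F]
    [MeasurableSpace W] [BorelSpace W] {q : W →L[ℝ] F} {N' : F →L[ℝ] F}
    (hq : ∀ x, q (N x) = N' (q x)) (hqe : q e = 0)
    (hker : ∀ x, N x ≠ 0 → q x = 0 → ∀ v, q v = 0 → v ∈ splitTangent N e x)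
    {x₀ : W} (hx₀ : N x₀ ≠ 0) (hqx₀ : q x₀ = 0) :
    IsMeasurableFoliation {x | N x ≠ 0} (splitTangent N e)
      {L | ∃ x, N x ≠ 0 ∧ L = splitOrbit N e x} := by
  refine ⟨_, isTransverseMeasure_count hq hqe hker, {x₀}, ⟨measurableSet_singleton x₀, ?_,
    fun L _ => (Set.countable_singleton x₀).mono Set.inter_subset_left⟩, ?_⟩
  · simpa using hx₀
  · have : ({x₀} : Set W) ∩ {x | q x = 0} = {x₀} := by
      ext x
      simp only [Set.mem_inter_iff, Set.mem_singleton_iff, Set.mem_ofPred_eq]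
      exact ⟨fun hx => hx.1, fun hx => ⟨hx, hx ▸ hqx₀⟩⟩
    simp [this]

end TransverseMeasure

/-! ### Chain rules for maps between manifolds and normed spaces -/

section Pi

theorem HasMFDerivAt.apply_pi {E : Type*} [NormedAddCommGroup E] [NormedSpace ℝ E]
    {M : Type*} [TopologicalSpace M] [ChartedSpace E M] {κ : Type*} [Fintype κ]
    {f : M → κ → ℝ} {x : M} {f' : E →L[ℝ] (κ → ℝ)}
    (h : HasMFDerivAt 𝓘(ℝ, E) 𝓘(ℝ, κ → ℝ) f x f') (i : κ) :
    HasMFDerivAt 𝓘(ℝ, E) 𝓘(ℝ, ℝ) (fun y => f y i) x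
      ((ContinuousLinearMap.proj (R := ℝ) (φ := fun _ : κ => ℝ) i).comp f') :=
  (ContinuousLinearMap.proj (R := ℝ) (φ := fun _ : κ => ℝ) i).hasFDerivAt.hasMFDerivAt.comp x h

theorem HasMFDerivAt.unique_apply {E E' : Type*} [NormedAddCommGroup E] [NormedSpace ℝ E]
    [NormedAddCommGroup E'] [NormedSpace ℝ E'] {M : Type*} [TopologicalSpace M] [ChartedSpace E M]
    {f : M → E'} {x : M} {f₁ f₂ : E →L[ℝ] E'} (h₁ : HasMFDerivAt 𝓘(ℝ, E) 𝓘(ℝ, E') f x f₁)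
    (h₂ : HasMFDerivAt 𝓘(ℝ, E) 𝓘(ℝ, E') f x f₂) (v : E) : f₁ v = f₂ v :=
  DFunLike.congr_fun (hasMFDerivAt_unique h₁ h₂) v

theorem HasMFDerivAt.comp_apply_eq {E E' : Type*} [NormedAddCommGroup E] [NormedSpace ℝ E]
    [NormedAddCommGroup E'] [NormedSpace ℝ E'] {M : Type*} [TopologicalSpace M] [ChartedSpace E M]
    {f₀ f : M → E'} {φ : M → M} {x : M} {f₀' f' : E →L[ℝ] E'} {φ' : E →L[ℝ] E}
    (h₀ : HasMFDerivAt 𝓘(ℝ, E) 𝓘(ℝ, E') f₀ x f₀') (hc : f₀ = f ∘ φ)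
    (hf : HasMFDerivAt 𝓘(ℝ, E) 𝓘(ℝ, E') f (φ x) f')
    (hφ : HasMFDerivAt 𝓘(ℝ, E) 𝓘(ℝ, E) φ x φ') (v : E) : f₀' v = f' (φ' v) := by
  subst hc
  exact h₀.unique_apply (hf.comp x hφ) v

theorem HasMFDerivAt.hasDerivAt_comp {E E' : Type*} [NormedAddCommGroup E] [NormedSpace ℝ E]
    [NormedAddCommGroup E'] [NormedSpace ℝ E'] {M : Type*} [TopologicalSpace M] [ChartedSpace E M]
    {f : M → E'} {γ : ℝ → M} {s : ℝ} {f' : E →L[ℝ] E'} {v : E}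
    (hf : HasMFDerivAt 𝓘(ℝ, E) 𝓘(ℝ, E') f (γ s) f')
    (hγ : HasMFDerivAt 𝓘(ℝ, ℝ) 𝓘(ℝ, E) γ s ((1 : ℝ →L[ℝ] ℝ).smulRight v)) :
    HasDerivAt (fun s => f (γ s)) (f' v) s := by
  have h : HasFDerivAt (fun s => f (γ s)) (f'.comp ((1 : ℝ →L[ℝ] ℝ).smulRight v)) s :=
    hasMFDerivAt_iff_hasFDerivAt.1 (hf.comp s hγ)
  simpa using h.hasDerivAt

end Pi

/-! ### The coadjoint orbit map and its differential -/

section Coadjoint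

variable {G : Type*} [TopologicalSpace G] [ChartedSpace Model5 G] [Group G]
  (X : Module.Basis (Fin 5) ℝ (GroupLieAlgebra (𝓡 5) G))

/-- The linear form on the Lie algebra with coordinates `F`. -/
noncomputable def coordForm (F : Fin 5 → ℝ) : Module.Dual ℝ (GroupLieAlgebra (𝓡 5) G) :=
  X.dualBasis.equivFun.symm F

/-- The linear form on the model space with coordinates `F`. -/
noncomputable def coordFormL (F : Fin 5 → ℝ) : Model5 →L[ℝ] ℝ :=
  LinearMap.toContinuousLinearMap (show Model5 →ₗ[ℝ] ℝ from X.dualBasis.equivFun.symm F)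

theorem coordForm_basis (F : Fin 5 → ℝ) (i : Fin 5) : coordForm X F (X i) = F i := by
  simp [coordForm, Module.Basis.equivFun_symm_apply, LinearMap.sum_apply, Finsupp.single_apply]

/-- The orbit map of `F` for the right action `F ↦ F ∘ Ad g`. -/
noncomputable def adOrbitMap (F : Fin 5 → ℝ) (g : G) : Fin 5 → ℝ :=
  fun i => coordForm X F (adjointMap g (X i))

theorem coordForm_adOrbitMap (F : Fin 5 → ℝ) (g : G) (v : GroupLieAlgebra (𝓡 5) G) :
    coordForm X (adOrbitMap X F g) v = coordForm X F (adjointMap g v) := by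
  have h : coordForm X (adOrbitMap X F g) = (coordForm X F).comp (adjointMap g) :=
    X.ext fun i => coordForm_basis X _ i
  exact LinearMap.congr_fun h v

theorem coadjointCoord_eq_adOrbitMap (g : G) (F : Fin 5 → ℝ) :
    coadjointCoord X g F = adOrbitMap X F g⁻¹ := by
  funext i
  simp only [coadjointCoord, Module.Basis.equivFun_apply, Module.Basis.dualBasis_repr]
  rfl

/-- Inversion permutes the group, so the right action F ∘ Ad g has the same orbits and spares the
inverse. -/
theorem kOrbit_eq_range_adOrbitMap (F : Fin 5 → ℝ) :
    kOrbit X F = Set.range (adOrbitMap X F) := by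
  ext y
  simp only [kOrbit, Set.mem_range, coadjointCoord_eq_adOrbitMap]
  exact ⟨fun ⟨g, hg⟩ => ⟨g⁻¹, hg⟩, fun ⟨g, hg⟩ => ⟨g⁻¹, by rwa [inv_inv]⟩⟩

theorem adjointMap_one (v : GroupLieAlgebra (𝓡 5) G) : adjointMap (1 : G) v = v :=
  DFunLike.congr_fun (lieAd_one (E := Model5) (G := G)) v

theorem adOrbitMap_one (F : Fin 5 → ℝ) : adOrbitMap X F 1 = F := by
  funext i
  rw [adOrbitMap, adjointMap_one, coordForm_basis]

/-- The infinitesimal action of the Lie algebra on its dual: `F ↦ F ∘ ad u`. -/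
noncomputable def adDual (u : GroupLieAlgebra (𝓡 5) G) : (Fin 5 → ℝ) →L[ℝ] (Fin 5 → ℝ) :=
  LinearMap.toContinuousLinearMap
    { toFun := fun F i => coordForm X F ⁅u, X i⁆
      map_add' := fun F F' => by
        funext i
        simp [coordForm, add_mul, Finset.sum_add_distrib]
      map_smul' := fun c F => by
        funext i
        simp [coordForm, Finset.mul_sum] }

theorem adDual_apply (u : GroupLieAlgebra (𝓡 5) G) (F : Fin 5 → ℝ) (i : Fin 5) :
    adDual X u F i = coordForm X F ⁅u, X i⁆ := rfl

variable [LieGroup (𝓡 5) ∞ G]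

theorem adjointMap_mul (g h : G) (v : GroupLieAlgebra (𝓡 5) G) :
    adjointMap (g * h) v = adjointMap g (adjointMap h v) :=
  DFunLike.congr_fun (lieAd_mul (E := Model5) g h) v

theorem adOrbitMap_mul (F : Fin 5 → ℝ) (g h : G) :
    adOrbitMap X F (g * h) = adOrbitMap X (adOrbitMap X F g) h := by
  funext i
  rw [adOrbitMap, adOrbitMap, coordForm_adOrbitMap, adjointMap_mul]

theorem hasMFDerivAt_adOrbitMap_apply (F : Fin 5 → ℝ) (g : G) (i : Fin 5) :
    HasMFDerivAt (𝓡 5) 𝓘(ℝ, ℝ) (fun g : G => adOrbitMap X F g i) g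
      ((coordFormL X F).comp
        (mfderiv (𝓡 5) 𝓘(ℝ, Model5) (fun g : G => lieAd (E := Model5) g (X i)) g :
          Model5 →L[ℝ] Model5)) := by
  have hs : ContMDiff (𝓡 5) 𝓘(ℝ, Model5) ∞ (fun g : G => lieAd (E := Model5) g (X i)) :=
    contMDiff_lieAd.clm_apply contMDiff_const
  exact (coordFormL X F).hasFDerivAt.hasMFDerivAt.comp
    g (hs.mdifferentiableAt (by simp)).hasMFDerivAt

theorem contMDiff_adOrbitMap (F : Fin 5 → ℝ) :
    ContMDiff (𝓡 5) 𝓘(ℝ, Fin 5 → ℝ) ∞ (adOrbitMap X F : G → Fin 5 → ℝ) := by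
  refine contMDiff_pi_space.2 fun i => ?_
  have h : ContMDiff (𝓡 5) 𝓘(ℝ, Model5) ∞ (fun g : G => lieAd (E := Model5) g (X i)) :=
    contMDiff_lieAd.clm_apply contMDiff_const
  exact (coordFormL X F).contDiff.contMDiff.comp h

/-- The differential of the orbit map, as a map between normed spaces. -/
noncomputable def adOrbitDeriv (F : Fin 5 → ℝ) (g : G) : Model5 →L[ℝ] (Fin 5 → ℝ) :=
  mfderiv (𝓡 5) 𝓘(ℝ, Fin 5 → ℝ) (adOrbitMap X F) g

theorem mdifferentiableAt_adOrbitMap (F : Fin 5 → ℝ) (g : G) :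
    MDifferentiableAt (𝓡 5) 𝓘(ℝ, Fin 5 → ℝ) (adOrbitMap X F) g :=
  (contMDiff_adOrbitMap X F).mdifferentiableAt (by simp)

theorem hasMFDerivAt_adOrbitMap (F : Fin 5 → ℝ) (g : G) :
    HasMFDerivAt (𝓡 5) 𝓘(ℝ, Fin 5 → ℝ) (adOrbitMap X F) g (adOrbitDeriv X F g) :=
  (mdifferentiableAt_adOrbitMap X F g).hasMFDerivAt

theorem adOrbitDeriv_one_apply (F : Fin 5 → ℝ) (u : GroupLieAlgebra (𝓡 5) G) (i : Fin 5) :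
    (adOrbitDeriv X F (1 : G) : Model5 → Fin 5 → ℝ) u i = adDual X u F i := by
  have h2 := (hasMFDerivAt_adOrbitMap X F 1).apply_pi i
  have key := h2.unique_apply (hasMFDerivAt_adOrbitMap_apply X F 1 i) u
  exact key.trans (congrArg (coordForm X F) (mfderiv_lieAd_apply (E := Model5) u (X i)))

theorem adOrbitDeriv_one (F : Fin 5 → ℝ) (u : GroupLieAlgebra (𝓡 5) G) :
    (adOrbitDeriv X F (1 : G) : Model5 → Fin 5 → ℝ) u = adDual X u F :=
  funext (adOrbitDeriv_one_apply X F u)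

/-- Left invariant vector fields, as maps to the model space. -/
noncomputable def leftInvariant (u : GroupLieAlgebra (𝓡 5) G) (g : G) : Model5 :=
  mulInvariantVectorField u g

/-- Left translation in the group moves the base point along its orbit, so the differential at `g`
reduces to the one at `1` for the moved point. -/
theorem adOrbitDeriv_leftInvariant (F : Fin 5 → ℝ) (g : G) (u : GroupLieAlgebra (𝓡 5) G) :
    adOrbitDeriv X F g (leftInvariant u g) = adDual X u (adOrbitMap X F g) := by
  have hc : adOrbitMap X (adOrbitMap X F g) = adOrbitMap X F ∘ (fun h : G => g * h) := by
    funext h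
    exact (adOrbitMap_mul X F g h).symm
  have hL : MDifferentiableAt (𝓡 5) (𝓡 5) (fun h : G => g * h) 1 :=
    (contMDiff_mul_left (a := g)).mdifferentiableAt (n := ∞) (by simp)
  have h2 := (hasMFDerivAt_adOrbitMap X (adOrbitMap X F g) 1).comp_apply_eq hc
    (hasMFDerivAt_adOrbitMap X F (g * 1)) hL.hasMFDerivAt u
  rw [mul_one] at h2
  exact h2.symm.trans (adOrbitDeriv_one X _ u)

theorem mulInvariantVectorField_surjective (g : G) (v : TangentSpace (𝓡 5) g) :
    ∃ u : GroupLieAlgebra (𝓡 5) G, mulInvariantVectorField u g = v := by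
  have hL : ∀ g h : G, MDifferentiableAt (𝓡 5) (𝓡 5) (fun h : G => g * h) h := fun g h =>
    (contMDiff_mul_left (a := g)).mdifferentiableAt (n := ∞) (by simp)
  have h1 : g⁻¹ * g = 1 := inv_mul_cancel g
  have hc : (fun h : G => g * h) ∘ (fun h : G => g⁻¹ * h) = id := by ext h; simp
  have key := mfderiv_comp g (hL g (g⁻¹ * g)) (hL g⁻¹ g)
  rw [hc] at key
  refine ⟨(mfderiv (𝓡 5) (𝓡 5) (fun h : G => g⁻¹ * h) g v : Model5), ?_⟩
  have key2 := DFunLike.congr_fun key v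
  rw [h1] at key2
  refine Eq.trans ?_ (key2.symm.trans (DFunLike.congr_fun (mfderiv_id (I := 𝓡 5) (x := g)) v))
  rfl

end Coadjoint

/-! ### Flows realized by group elements, and the dimension of orbits -/

section CoadjointFlow

variable {G : Type*} [TopologicalSpace G] [ChartedSpace Model5 G] [Group G]
  (X : Module.Basis (Fin 5) ℝ (GroupLieAlgebra (𝓡 5) G))

/-- The action of `g` on the dual of the Lie algebra, in coordinates. -/
noncomputable def adAction (g : G) : (Fin 5 → ℝ) →L[ℝ] (Fin 5 → ℝ) :=
  LinearMap.toContinuousLinearMap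
    { toFun := fun F => adOrbitMap X F g
      map_add' := fun F F' => by
        funext i
        simp [adOrbitMap, coordForm, add_mul, Finset.sum_add_distrib]
      map_smul' := fun c F => by
        funext i
        simp [adOrbitMap, coordForm, Finset.mul_sum] }

theorem adAction_apply (g : G) (F : Fin 5 → ℝ) : adAction X g F = adOrbitMap X F g := rfl

theorem adDual_basis_skew (F : Fin 5 → ℝ) (i j : Fin 5) :
    adDual X (X i) F j = -adDual X (X j) F i := by
  rw [adDual_apply, adDual_apply, GroupLieAlgebra.bracket_def, VectorField.mlieBracket_swap_apply,
    ← GroupLieAlgebra.bracket_def]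
  exact map_neg (coordForm X F) _

variable [LieGroup (𝓡 5) ∞ G]

theorem lieGroup_minSmoothness : LieGroup (𝓡 5) (minSmoothness ℝ 3) G := by
  rw [minSmoothness_of_isRCLikeNormedField]
  exact LieGroup.of_le (n := ∞) (mod_cast le_top : ((3 : ℕ∞) : WithTop ℕ∞) ≤ ∞)

/-- The flow of `F ↦ F ∘ ad u` is given by elements of the group. -/
theorem exists_adOrbitMap_eq_linFlow (u : GroupLieAlgebra (𝓡 5) G) (t : ℝ) :
    ∃ g : G, ∀ F, adOrbitMap X F g = linFlow (adDual X u) t F := by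
  have : LieGroup (𝓡 5) (minSmoothness ℝ 3) G := lieGroup_minSmoothness
  have : IsManifold (𝓡 5) 1 G := .of_le (n := ∞) (by simp)
  obtain ⟨γ, hγ0, hγ⟩ := exists_isMIntegralCurveAt_of_contMDiffAt_boundaryless (I := 𝓡 5)
    (v := fun g : G => mulInvariantVectorField u g) 0 (x₀ := (1 : G))
    ((contMDiff_mulInvariantVectorField u).contMDiffAt.of_le (by
      rw [minSmoothness_of_isRCLikeNormedField]; norm_num))
  obtain ⟨r, hr, hball⟩ := Metric.eventually_nhds_iff_ball.1 hγ
  -- An integral curve of the left invariant field is known only for short times, where the orbit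
  -- map carries it to a solution of the linear equation. Other times are reached by powers of `γ (t
  -- / n)`.
  have hflow : ∀ s ∈ Set.Ioo (-r) r, ∀ F, adOrbitMap X F (γ s) = linFlow (adDual X u) s F := by
    intro s hs F
    have h := eq_linFlow_of_hasDerivAt (adDual X u) (y := fun s => adOrbitMap X F (γ s)) (r := r)
      (fun s hs => by
        have h1 := hball s (by rw [Real.ball_eq_Ioo]; simpa using hs)
        have h2 := (hasMFDerivAt_adOrbitMap X F (γ s)).hasDerivAt_comp
          (v := leftInvariant u (γ s)) h1
        rwa [adOrbitDeriv_leftInvariant] at h2) hs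
    simpa [hγ0, adOrbitMap_one] using h
  obtain ⟨n, hn⟩ := exists_nat_gt (|t| / r)
  have hn0 : (0 : ℝ) < n := lt_of_le_of_lt (by positivity) hn
  have htn : t / n ∈ Set.Ioo (-r) r := by
    rw [Set.mem_Ioo, ← abs_lt, abs_div, Nat.abs_cast, div_lt_iff₀ hn0]
    rw [div_lt_iff₀ hr] at hn
    linarith [mul_comm (n : ℝ) r]
  refine ⟨γ (t / n) ^ n, fun F => ?_⟩
  have hpow : ∀ k : ℕ, adOrbitMap X F (γ (t / n) ^ k) = (linFlow (adDual X u) (t / n))^[k] F := by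
    intro k
    induction k with
    | zero => simp [adOrbitMap_one]
    | succ k ih => rw [pow_succ, adOrbitMap_mul, ih, hflow _ htn, Function.iterate_succ_apply']
  rw [hpow, ← linFlow_nsmul, mul_div_cancel₀ _ hn0.ne']

/-- If the infinitesimal action vanishes at a point of the orbit, then it vanishes at the base
point. -/
theorem adDual_eq_zero_of_adOrbitMap {F : Fin 5 → ℝ} {g : G}
    (h0 : ∀ u, adDual X u (adOrbitMap X F g) = 0) (u : GroupLieAlgebra (𝓡 5) G) :
    adDual X u F = 0 := by
  set F' := adOrbitMap X F g with hF'
  -- Writing the right action as a dot, F·h = (F'·(g⁻¹hg))·g⁻¹, and conjugation fixes `1`. So a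
  -- vanishing differential at `F'` forces one at `F`.
  have hc : adOrbitMap X F =
      (fun h => adAction X g⁻¹ (adOrbitMap X F' h)) ∘ (fun h : G => g⁻¹ * h * g) := by
    funext h
    rw [Function.comp_apply, adAction_apply, hF', ← adOrbitMap_mul, ← adOrbitMap_mul]
    congr 1
    group
  have hφ : MDifferentiableAt (𝓡 5) (𝓡 5) (fun h : G => g⁻¹ * h * g) 1 :=
    ((contMDiff_mul_left (a := g⁻¹)).mul contMDiff_const).mdifferentiableAt (n := ∞) (by simp)
  have hf : HasMFDerivAt (𝓡 5) 𝓘(ℝ, Fin 5 → ℝ) (fun h => adAction X g⁻¹ (adOrbitMap X F' h))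
      (g⁻¹ * 1 * g) ((adAction X g⁻¹).comp (adOrbitDeriv X F' (g⁻¹ * 1 * g))) :=
    (adAction X g⁻¹).hasFDerivAt.hasMFDerivAt.comp _ (hasMFDerivAt_adOrbitMap X F' _)
  have key := (hasMFDerivAt_adOrbitMap X F 1).comp_apply_eq hc hf hφ.hasMFDerivAt u
  rw [show g⁻¹ * 1 * g = 1 by group] at key
  rw [← adOrbitDeriv_one]
  refine key.trans ?_
  refine (congrArg (adAction X g⁻¹) ((adOrbitDeriv_one X F' _).trans (h0 _))).trans ?_
  exact map_zero _

/-- The infinitesimal action at `F`, as a linear map on the Lie algebra. -/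
noncomputable def adDualAt (F : Fin 5 → ℝ) : GroupLieAlgebra (𝓡 5) G →ₗ[ℝ] (Fin 5 → ℝ) where
  toFun u := adDual X u F
  map_add' u v := by
    have : LieGroup (𝓡 5) (minSmoothness ℝ 3) G := lieGroup_minSmoothness
    funext i
    exact (congrArg (coordForm X F) (add_lie u v (X i))).trans (map_add _ _ _)
  map_smul' c u := by
    have : LieGroup (𝓡 5) (minSmoothness ℝ 3) G := lieGroup_minSmoothness
    funext i
    exact (congrArg (coordForm X F) (smul_lie c u (X i))).trans (map_smul _ _ _)

/-- The two orbit maps differ by inversion, an involution. Factoring each through the other gives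
both inclusions of ranges without computing the differential of inversion. -/
theorem kOrbitDim_eq (F : Fin 5 → ℝ) :
    kOrbitDim X F = Module.finrank ℝ (LinearMap.range (adDualAt X F)) := by
  have hco : (fun g : G => coadjointCoord X g F) = adOrbitMap X F ∘ (fun g : G => g⁻¹) := by
    funext g
    exact coadjointCoord_eq_adOrbitMap X g F
  have hco' : adOrbitMap X F = (fun g : G => coadjointCoord X g F) ∘ (fun g : G => g⁻¹) := by
    funext g
    rw [hco]
    simp
  have hinv : MDifferentiableAt (𝓡 5) (𝓡 5) (fun g : G => g⁻¹) 1 :=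
    (contMDiff_inv (𝓡 5) ∞).mdifferentiableAt (by simp)
  have hd : ∀ g : G, MDifferentiableAt (𝓡 5) 𝓘(ℝ, Fin 5 → ℝ)
      (fun g : G => coadjointCoord X g F) g := fun g => by
    rw [hco]
    exact ((contMDiff_adOrbitMap X F).comp (contMDiff_inv (𝓡 5) ∞)).mdifferentiableAt (by simp)
  obtain ⟨T, hT⟩ : ∃ T : Model5 →L[ℝ] Model5,
      HasMFDerivAt (𝓡 5) (𝓡 5) (fun g : G => g⁻¹) 1 T := ⟨_, hinv.hasMFDerivAt⟩
  obtain ⟨D, hD, hD'⟩ : ∃ D : G → (Model5 →L[ℝ] (Fin 5 → ℝ)),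
      (∀ g, HasMFDerivAt (𝓡 5) 𝓘(ℝ, Fin 5 → ℝ) (fun g : G => coadjointCoord X g F) g (D g)) ∧
      kOrbitDim X F = Module.finrank ℝ (LinearMap.range (D 1).toLinearMap) :=
    ⟨fun g => mfderiv (𝓡 5) 𝓘(ℝ, Fin 5 → ℝ) (fun g : G => coadjointCoord X g F) g,
      fun g => (hd g).hasMFDerivAt, rfl⟩
  have h1 := (hD 1).comp_apply_eq hco (hasMFDerivAt_adOrbitMap X F 1⁻¹) hT
  have h2 := (hasMFDerivAt_adOrbitMap X F 1).comp_apply_eq hco' (hD 1⁻¹) hT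
  rw [inv_one] at h1 h2
  have hrange : LinearMap.range (D 1).toLinearMap = LinearMap.range (adDualAt X F) := by
    ext y
    constructor
    · rintro ⟨v, rfl⟩
      exact ⟨_, ((h1 v).trans (adOrbitDeriv_one X F _)).symm⟩
    · rintro ⟨u, rfl⟩
      exact ⟨T u, ((adOrbitDeriv_one X F u).symm.trans (h2 u)).symm⟩
  rw [hD', hrange]

end CoadjointFlow

/-! ### The K-orbits of the groups in the list -/

section MD5

/-- What the rest needs from the list: the dual vector of X₅ is an eigenvector of the transpose of
`A` with nonzero eigenvalue. -/
theorem IsMD5Matrix.last_row {A : Matrix (Fin 3) (Fin 3) ℝ} (hA : IsMD5Matrix A) :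
    A 2 0 = 0 ∧ A 2 1 = 0 ∧ A 2 2 ≠ 0 := by
  cases hA <;> simp_all

theorem fin_five_cases (l : Fin 5) : l = 0 ∨ l = 1 ∨ ∃ j : Fin 3, l = Fin.natAdd 2 j := by
  revert l
  decide

variable {G : Type*} [TopologicalSpace G] [ChartedSpace Model5 G] [Group G]
  {A : Matrix (Fin 3) (Fin 3) ℝ} {X : Module.Basis (Fin 5) ℝ (GroupLieAlgebra (𝓡 5) G)}

namespace IsMD5Basis

theorem adDual_one_apply (hX : IsMD5Basis A X) (F : Fin 5 → ℝ) :
    adDual X (X 1) F 0 = -F 2 ∧ adDual X (X 1) F 1 = 0 ∧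
      ∀ j : Fin 3, adDual X (X 1) F (Fin.natAdd 2 j) = ∑ i, A i j * F (Fin.natAdd 2 i) := by
  refine ⟨?_, ?_, fun j => ?_⟩
  · rw [adDual_basis_skew, adDual_apply, hX.bracket_zero_one, coordForm_basis]
  · have h := adDual_basis_skew X F 1 1
    linarith
  · rw [adDual_apply, hX.bracket_one, map_sum]
    exact Finset.sum_congr rfl fun i _ => by
      rw [map_smul, coordForm_basis, smul_eq_mul]

theorem adDual_one_eq (hX : IsMD5Basis A X) (F : Fin 5 → ℝ) :
    adDual X (X 1) F = ![-F 2, 0, A 0 0 * F 2 + A 1 0 * F 3 + A 2 0 * F 4,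
      A 0 1 * F 2 + A 1 1 * F 3 + A 2 1 * F 4, A 0 2 * F 2 + A 1 2 * F 3 + A 2 2 * F 4] := by
  obtain ⟨h0, h1, h2⟩ := hX.adDual_one_apply F
  have e : ∀ j : Fin 3, ∑ i, A i j * F (Fin.natAdd 2 i) =
      A 0 j * F 2 + A 1 j * F 3 + A 2 j * F 4 := fun j => by
    rw [Fin.sum_univ_three]
    rfl
  funext l
  fin_cases l
  · exact h0
  · exact h1
  · exact (h2 0).trans (e 0)
  · exact (h2 1).trans (e 1)
  · exact (h2 2).trans (e 2)

/-- No bracket has an X₂-component, so `N` does not see that coordinate, and [X₂, X₂] = 0 makes the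
X₂-coordinate of N F vanish. -/
theorem isSplitFlow (hX : IsMD5Basis A X) :
    IsSplitFlow (adDual X (X 1)) (Pi.single 1 1 : Fin 5 → ℝ)
      (ContinuousLinearMap.proj (R := ℝ) (φ := fun _ : Fin 5 => ℝ) 1) where
  apply_vector := by
    rw [hX.adDual_one_eq]
    funext l
    fin_cases l <;> simp
  form_vector := by simp
  form_apply F := (hX.adDual_one_apply F).2.1

/-- The basis vectors other than X₂ commute, so only the coordinate at X₂ survives; antisymmetry
expresses it by N F. -/
theorem adDual_basis_of_ne (hX : IsMD5Basis A X) {l : Fin 5} (hl : l ≠ 1) (F : Fin 5 → ℝ) :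
    adDual X (X l) F = -(adDual X (X 1) F l) • (Pi.single 1 1 : Fin 5 → ℝ) := by
  have hzero : ∀ j : Fin 3, adDual X (X 0) F (Fin.natAdd 2 j) = 0 := fun j => by
    rw [adDual_apply, hX.bracket_zero, map_zero]
  have hself : adDual X (X 0) F 0 = 0 := by
    have h := adDual_basis_skew X F 0 0
    linarith
  have hder : ∀ i j : Fin 3, adDual X (X (Fin.natAdd 2 i)) F (Fin.natAdd 2 j) = 0 := fun i j => by
    rw [adDual_apply, hX.bracket_derived, map_zero]
  have hne : ∀ j : Fin 3, Fin.natAdd 2 j ≠ (1 : Fin 5) := by decide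
  funext m
  rcases fin_five_cases m with rfl | rfl | ⟨j, rfl⟩
  · rcases fin_five_cases l with rfl | rfl | ⟨i, rfl⟩
    · simp [hself]
    · exact absurd rfl hl
    · rw [adDual_basis_skew, hzero]
      simp
  · rw [adDual_basis_skew]
    simp
  · rcases fin_five_cases l with rfl | rfl | ⟨i, rfl⟩
    · rw [hzero]
      simp [hne]
    · exact absurd rfl hl
    · rw [hder]
      simp [hne]

theorem adDual_single_ne_zero (hA : IsMD5Matrix A) (hX : IsMD5Basis A X) :
    adDual X (X 1) (Pi.single 4 1) ≠ 0 := by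
  intro h
  have := congrFun h 4
  rw [hX.adDual_one_eq] at this
  exact hA.last_row.2.2 (by simpa using this)

/-- The two half-planes `{(0, β, 0, 0, σ) | ± σ > 0}` are closed leaves, and their counting measure
is a transverse measure. -/
theorem isMeasurableFoliation (hA : IsMD5Matrix A) (hX : IsMD5Basis A X) :
    IsMeasurableFoliation {F | adDual X (X 1) F ≠ 0}
      (splitTangent (adDual X (X 1)) (Pi.single 1 1))
      {L | ∃ F, adDual X (X 1) F ≠ 0 ∧ L = splitOrbit (adDual X (X 1)) (Pi.single 1 1) F} := by
  obtain ⟨hA0, hA1, hA2⟩ := hA.last_row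
  -- The projection `q` forgets the coordinates at X₂ and X₅. Neither enters the remaining
  -- coordinates of N F, by the zeros in the last row of `A`, so `q ∘ N` factors through `q`.
  let q : (Fin 5 → ℝ) →L[ℝ] (Fin 5 → ℝ) := ContinuousLinearMap.pi
    ![ContinuousLinearMap.proj 0, 0, ContinuousLinearMap.proj 2, ContinuousLinearMap.proj 3, 0]
  have hq : ∀ F, q F = ![F 0, 0, F 2, F 3, 0] := fun F => by
    funext l
    fin_cases l <;> rfl
  have hq0 : ∀ F, q F = 0 → F 0 = 0 ∧ F 2 = 0 ∧ F 3 = 0 := fun F hF => by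
    rw [hq] at hF
    exact ⟨congrFun hF 0, congrFun hF 2, congrFun hF 3⟩
  refine isMeasurableFoliation_of_comp_eq (q := q) (N' := q.comp (adDual X (X 1)))
    (fun F => ?_) ?_ (fun F hF hqF v hv => ?_) (x₀ := Pi.single 4 1)
    (hX.adDual_single_ne_zero hA) ?_
  · rw [ContinuousLinearMap.comp_apply, hX.adDual_one_eq, hX.adDual_one_eq, hq, hq, hq]
    simp [hA0, hA1]
  · rw [hq]
    funext l
    fin_cases l <;> simp
  · obtain ⟨f0, f2, f3⟩ := hq0 F hqF
    obtain ⟨v0, v2, v3⟩ := hq0 v hv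
    rw [hX.adDual_one_eq] at hF
    have hF4 : A 2 2 * F 4 ≠ 0 := by
      intro h4
      apply hF
      funext l
      fin_cases l <;> simp [f2, f3, h4, hA0, hA1]
    -- On the zero set of `q`, N F has the single nonzero entry A₂₂F₄, in the last place.
    refine mem_splitTangent.2 ⟨v 1, v 4 / (A 2 2 * F 4), ?_⟩
    rw [hX.adDual_one_eq]
    funext l
    fin_cases l <;> simp [f2, f3, v0, v2, v3, hA0, hA1]
    exact div_mul_cancel₀ _ hF4
  · rw [hq]
    funext l
    fin_cases l <;> simp

variable [LieGroup (𝓡 5) ∞ G]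

theorem range_adDualAt_le (hX : IsMD5Basis A X) (F : Fin 5 → ℝ) :
    LinearMap.range (adDualAt X F) ≤ splitTangent (adDual X (X 1)) (Pi.single 1 1) F := by
  rw [LinearMap.range_eq_map, ← X.span_eq, Submodule.map_span_le]
  rintro _ ⟨l, rfl⟩
  by_cases hl : l = 1
  · subst hl
    exact mem_splitTangent.2 ⟨0, 1, by simp [adDualAt]⟩
  · refine mem_splitTangent.2 ⟨-(adDual X (X 1) F l), 0, ?_⟩
    rw [zero_smul, add_zero]
    exact (hX.adDual_basis_of_ne hl F).symm

theorem range_adDualAt_eq (hX : IsMD5Basis A X) {F : Fin 5 → ℝ} (hF : adDual X (X 1) F ≠ 0) :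
    LinearMap.range (adDualAt X F) = splitTangent (adDual X (X 1)) (Pi.single 1 1) F := by
  refine le_antisymm (hX.range_adDualAt_le F) (Submodule.span_le.2 ?_)
  have h1 : adDual X (X 1) F ∈ LinearMap.range (adDualAt X F) := ⟨X 1, rfl⟩
  obtain ⟨l, hl⟩ := Function.ne_iff.1 hF
  have hl1 : l ≠ 1 := by
    rintro rfl
    exact hl (hX.adDual_one_apply F).2.1
  have h2 : (Pi.single 1 1 : Fin 5 → ℝ) ∈ LinearMap.range (adDualAt X F) := by
    have h3 : adDual X (X l) F ∈ LinearMap.range (adDualAt X F) := ⟨X l, rfl⟩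
    rw [hX.adDual_basis_of_ne hl1] at h3
    exact (Submodule.smul_mem_iff _ (neg_ne_zero.2 hl)).1 h3
  rintro v (rfl | rfl)
  · exact h2
  · exact h1

theorem adDual_eq_zero (hX : IsMD5Basis A X) {F : Fin 5 → ℝ} (hF : adDual X (X 1) F = 0)
    (u : GroupLieAlgebra (𝓡 5) G) : adDual X u F = 0 := by
  have h : adDualAt X F = 0 := X.ext fun l => by
    by_cases hl : l = 1
    · subst hl
      exact hF
    · refine (hX.adDual_basis_of_ne hl F).trans ?_
      simp [hF]
  exact LinearMap.congr_fun h u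

theorem kOrbitDim_of_ne_zero (hX : IsMD5Basis A X) {F : Fin 5 → ℝ}
    (hF : adDual X (X 1) F ≠ 0) : kOrbitDim X F = 2 := by
  rw [kOrbitDim_eq, hX.range_adDualAt_eq hF, splitTangent]
  have h := finrank_span_eq_card (hX.isSplitFlow.linearIndependent hF)
  rw [Fintype.card_fin, Matrix.range_cons_cons_empty] at h
  exact h

theorem kOrbitDim_of_eq_zero (hX : IsMD5Basis A X) {F : Fin 5 → ℝ}
    (hF : adDual X (X 1) F = 0) : kOrbitDim X F = 0 := by
  have h : adDualAt X F = 0 := LinearMap.ext fun u => hX.adDual_eq_zero hF u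
  rw [kOrbitDim_eq, h, LinearMap.range_zero, finrank_bot]

/-- The K-orbits through the points with non-trivial infinitesimal action. -/
theorem kOrbit_eq_splitOrbit [PreconnectedSpace G] (hX : IsMD5Basis A X) {F : Fin 5 → ℝ}
    (hF : adDual X (X 1) F ≠ 0) :
    kOrbit X F = splitOrbit (adDual X (X 1)) (Pi.single 1 1) F := by
  rw [kOrbit_eq_range_adOrbitMap]
  refine Set.Subset.antisymm ?_ ?_
  · rintro _ ⟨g, rfl⟩
    have h := hX.isSplitFlow.mem_splitOrbit_of_connected (contMDiff_adOrbitMap X F)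
      (fun g v => by
        obtain ⟨u, rfl⟩ := mulInvariantVectorField_surjective g v
        have h1 := adOrbitDeriv_leftInvariant X F g u
        have h2 := hX.range_adDualAt_le (adOrbitMap X F g) ⟨u, rfl⟩
        exact (congrArg (· ∈ splitTangent (adDual X (X 1)) (Pi.single 1 1) (adOrbitMap X F g))
          h1).mpr h2)
      (fun g h0 => hF (adDual_eq_zero_of_adOrbitMap X
        (fun u => hX.adDual_eq_zero h0 u) (X 1))) 1 g
    rwa [adOrbitMap_one] at h
  · rintro _ ⟨⟨t, b⟩, rfl⟩
    obtain ⟨g, hg⟩ := exists_adOrbitMap_eq_linFlow X (X 1) t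
    set F' := linFlow (adDual X (X 1)) t F with hF'
    have hF'0 : adDual X (X 1) F' ≠ 0 := by
      rw [hF', apply_linFlow]
      exact (map_ne_zero_iff _ (linFlow_injective _ t)).2 hF
    -- Translation by `b • e` comes from a generator X_l with (N F')_l ≠ 0. It moves F' at velocity
    -- -(N F')_l e and kills `e`, which fixes the time chosen below.
    obtain ⟨l, hl⟩ := Function.ne_iff.1 hF'0
    have hl1 : l ≠ 1 := by
      rintro rfl
      exact hl (hX.adDual_one_apply F').2.1
    obtain ⟨k, hk⟩ := exists_adOrbitMap_eq_linFlow X (X l) (-(b / adDual X (X 1) F' l))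
    have hsq : adDual X (X l) (adDual X (X l) F') = 0 := by
      rw [hX.adDual_basis_of_ne hl1 F', map_smul, hX.adDual_basis_of_ne hl1,
        hX.isSplitFlow.apply_vector]
      simp
    refine ⟨g * k, ?_⟩
    rw [adOrbitMap_mul, hg, ← hF', hk, linFlow_of_apply_apply_eq_zero _ hsq,
      hX.adDual_basis_of_ne hl1 F', smul_smul, neg_mul_neg]
    congr 2
    exact div_mul_cancel₀ b hl

/-- Orbit dimensions are 0 or 2, according to whether N F vanishes, and 2 is attained at the dual
vector of X₅. -/
theorem maximalKOrbits_eq [PreconnectedSpace G] (hA : IsMD5Matrix A) (hX : IsMD5Basis A X) :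
    maximalKOrbits X = {L | ∃ F, adDual X (X 1) F ≠ 0 ∧
      L = splitOrbit (adDual X (X 1)) (Pi.single 1 1) F} := by
  have hle : ∀ F, kOrbitDim X F ≤ 2 := fun F => by
    by_cases hF : adDual X (X 1) F = 0
    · simp [hX.kOrbitDim_of_eq_zero hF]
    · exact (hX.kOrbitDim_of_ne_zero hF).le
  ext L
  constructor
  · rintro ⟨F, hmax, rfl⟩
    have hF : adDual X (X 1) F ≠ 0 := by
      intro h0
      have := hmax (Pi.single 4 1)
      rw [hX.kOrbitDim_of_eq_zero h0,
        hX.kOrbitDim_of_ne_zero (hX.adDual_single_ne_zero hA)] at this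
      omega
    exact ⟨F, hF, hX.kOrbit_eq_splitOrbit hF⟩
  · rintro ⟨F, hF, rfl⟩
    exact ⟨F, fun F' => (hle F').trans (hX.kOrbitDim_of_ne_zero hF).ge,
      (hX.kOrbit_eq_splitOrbit hF).symm⟩

theorem sUnion_maximalKOrbits [PreconnectedSpace G] (hA : IsMD5Matrix A) (hX : IsMD5Basis A X) :
    ⋃₀ maximalKOrbits X = {F | adDual X (X 1) F ≠ 0} := by
  rw [hX.maximalKOrbits_eq hA]
  ext F
  constructor
  · rintro ⟨_, ⟨F', hF', rfl⟩, hF⟩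
    exact hX.isSplitFlow.apply_ne_zero_of_mem_splitOrbit hF hF'
  · intro hF
    exact ⟨_, ⟨F, hF, rfl⟩, self_mem_splitOrbit F⟩

end IsMD5Basis

end MD5

theorem theorem3p3p1 {G : Type*} [TopologicalSpace G] [ChartedSpace Model5 G] [Group G]
    [LieGroup (𝓡 5) ∞ G] [SimplyConnectedSpace G]
    (A : Matrix (Fin 3) (Fin 3) ℝ) (hA : IsMD5Matrix A)
    (X : Module.Basis (Fin 5) ℝ (GroupLieAlgebra (𝓡 5) G)) (hX : IsMD5Basis A X) :
    (∀ F ∈ ⋃₀ maximalKOrbits X, kOrbitDim X F = 2) ∧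
    ∃ (P : (Fin 5 → ℝ) → Submodule ℝ (Fin 5 → ℝ)) (Y : (Fin 5 → ℝ) → ⋀[ℝ]^2 (Fin 5 → ℝ)),
      IsFoliation 2 (⋃₀ maximalKOrbits X) P (maximalKOrbits X) ∧
      IsTangentMultivectorField 2 (⋃₀ maximalKOrbits X) P Y ∧
      IsMeasurableFoliation (⋃₀ maximalKOrbits X) P (maximalKOrbits X) := by
  rw [hX.sUnion_maximalKOrbits hA, hX.maximalKOrbits_eq hA]
  exact ⟨fun F hF => hX.kOrbitDim_of_ne_zero hF, _, _, hX.isSplitFlow.isFoliation,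
    hX.isSplitFlow.isTangentMultivectorField, hX.isMeasurableFoliation hA⟩
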